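/- Let $X$ be a complex Banach space, $-1<\gamma<0$, $0<\omega<\pi/2$, $0<\alpha<\frac{\pi}{2\omega}$ and $0<T<\infty$. For $0<\mu<\pi$ put $S_\mu^0=\{z\in\mathbb C\setminus\{0\}:|\arg z|<\mu\}$ and $S_\mu=\{z\in\mathbb C\setminus\{0\}:|\arg z|\le\mu\}\cup\{0\}$. Let $A:D(A)\subset X\to X$ be an almost sectorial operator of class $\Theta_\omega^\gamma$, that is, a closed (not necessarily densely defined) linear operator with $\sigma(A)\subset S_\omega$ such that for every $\omega<\mu<\pi$ there is $C_\mu>0$ with $\|(z-A)^{-1}\|\le C_\mu|z|^\gamma$ for all $z\notin S_\mu$. Let $\phi:[0,\infty)\to[0,\infty)$ be continuous with $\phi(t)>0$ for $t>0$. For $0<\theta<\pi$ let $\Gamma_\theta$ be the path $\{\rho e^{-i\theta}:\rho>0\}\cup\{\rho e^{i\theta}:\rho>0\}$, oriented so that $S_\theta^0$ lies to its left. For $t\in S^0_{\frac\pi2-\alpha\omega}$ let $$\mathscr T_\alpha(t)=\frac1{2\pi i}\int_{\Gamma_\theta}e^{-tz^\alpha}(z-A)^{-1}\,dz,\qquad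 \omega<\theta<\min\Big\{\pi,\frac{\pi-2|\arg t|}{2\alpha}\Big\},$$ with the principal branch of $z^\alpha$. Let $A^\alpha$ be the fractional power of $A$ given by the functional calculus, $A^\alpha=(1+A)^n\,f_n(A)$ with its natural domain, where $f_n(z)=z^\alpha(1+z)^{-n}$, $n=\lceil\alpha\rceil+1$, and $f_n(A)=\frac1{2\pi i}\int_{\Gamma_\theta}f_n(z)(z-A)^{-1}dz$, $\omega<\theta<\pi$. Consider the problem $$u_t(t)=-\phi(t)A^\alpha u(t),\quad 0<t<T,\qquad u(0)=u_0\in X. \tag{P}$$ A classical solution is a function $u\in C^1((0,T);X)$ with values in $D(A^\alpha)$ that satisfies the differential equation on $(0,T)$ and has the initial value $u_0$ in the sense that $(\lambda-A)^{-1}u(t)\to(\lambda-A)^{-1}u_0$ in $X$ as $t\to0^+$ for all $\lambda\in\rho(A)$ (equivalently, for $\lambda=0\in\rho(A)$: $A^{-1}u(t)\to A^{-1}u_0$). Theorem. The integral defining $\mathscr T_\alpha(t)$ converges absolutely and does not depend on $\theta$, and $\{\mathscr T_\alpha(t):t\in S^0_{\frac\pi2-\alpha\omega}\}$ is an analytic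 semigroup of growth order $\kappa=\frac{1+\gamma}{\alpha}$, that is: $\mathscr T_\alpha(t+s)=\mathscr T_\alpha(t)\mathscr T_\alpha(s)$ for $t,s$ in the sector; $t\mapsto\mathscr T_\alpha(t)$ is analytic there; there is $C>0$ with $\|\mathscr T_\alpha(t)\|\le Ct^{-\kappa}$ for all real $t>0$; and $\mathscr T_\alpha(t)x=0$ for some $t$ in the sector implies $x=0$. The solution operator of (P) is $$\mathscr T_{\alpha,\phi}(t)=\mathscr T_\alpha\Big(\int_0^t\phi(s)\,ds\Big),\qquad 0<t<T,$$ that is, for every $u_0\in X$ the function $u(t)=\mathscr T_{\alpha,\phi}(t)u_0$, $0<t<T$, is a classical solution of (P), and it is the only one. Moreover, for given $u_0\in X$, a function $u\in C^1((0,T);X)$ with values in $D(A^\alpha)$ that satisfies the differential equation of (P) on $(0,T)$ and $\lim_{t\to0^+}u(t)=u_0$ in the norm of $X$ exists if and only if $u_0$ is in the continuity set $\{x\in X:\lim_{t\to0^+}\mathscr T_\alpha(t)x=x\}$, and it is then $u(t)=\mathscr T_{\alpha,\phi}(t)u_0$. -/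

import Mathlib

open Set Filter Topology MeasureTheory

noncomputable section

namespace AlmostSectorial

/-- The open sector of half-angle `μ`, without its vertex. -/
def openSector (μ : ℝ) : Set ℂ := {z | z ≠ 0 ∧ |z.arg| < μ}

/-- The closed sector of half-angle `μ`, with its vertex. -/
def closedSector (μ : ℝ) : Set ℂ := {z | z ≠ 0 ∧ |z.arg| ≤ μ} ∪ {0}

variable {X : Type*} [NormedAddCommGroup X] [NormedSpace ℂ X]

/-- The bounded operator `R` is a two-sided inverse of `z - A : D(A) → X`. -/
def IsResolventAt (A : X →ₗ.[ℂ] X) (z : ℂ) (R : X →L[ℂ] X) : Prop :=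
  (∀ x : X, ∃ h : R x ∈ A.domain, z • R x - A ⟨R x, h⟩ = x) ∧
    ∀ x : A.domain, R (z • (x : X) - A x) = x

/-- The resolvent set `ρ(A)`. -/
def resolventSet (A : X →ₗ.[ℂ] X) : Set ℂ := {z | ∃ R, IsResolventAt A z R}

/-- The spectrum `σ(A)`. -/
def spectrumSet (A : X →ₗ.[ℂ] X) : Set ℂ := (resolventSet A)ᶜ

open Classical in
/-- The resolvent `(z - A)⁻¹` for `z ∈ ρ(A)` (and `0` for `z ∈ σ(A)`). -/
def resolventOp (A : X →ₗ.[ℂ] X) (z : ℂ) : X →L[ℂ] X :=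
  if h : ∃ R, IsResolventAt A z R then h.choose else 0

theorem isResolventAt_resolventOp {A : X →ₗ.[ℂ] X} {z : ℂ} (hz : z ∈ resolventSet A) :
    IsResolventAt A z (resolventOp A z) := by
  have h : ∃ R, IsResolventAt A z R := hz
  rw [resolventOp, dif_pos h]
  exact h.choose_spec

theorem resolventOp_injective {A : X →ₗ.[ℂ] X} {z : ℂ} (hz : z ∈ resolventSet A) :
    Function.Injective (resolventOp A z) := by
  intro x y hxy
  obtain ⟨h₁, e₁⟩ := (isResolventAt_resolventOp hz).1 x
  obtain ⟨h₂, e₂⟩ := (isResolventAt_resolventOp hz).1 y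
  rw [← e₁, ← e₂]
  have e : (⟨resolventOp A z x, h₁⟩ : A.domain) = ⟨resolventOp A z y, h₂⟩ := Subtype.ext hxy
  rw [e, hxy]

/-- The class `Θ_ω^γ(X)` of almost sectorial operators. -/
structure IsAlmostSectorial (A : X →ₗ.[ℂ] X) (ω γ : ℝ) : Prop where
  closed : A.IsClosed
  spectrum_subset : spectrumSet A ⊆ closedSector ω
  resolvent_bound : ∀ μ : ℝ, ω < μ → μ < Real.pi →
    ∃ C : ℝ, 0 < C ∧ ∀ z : ℂ, z ∉ closedSector μ → ‖resolventOp A z‖ ≤ C * ‖z‖ ^ γ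

/-- The point `r e^{iθ}`. -/
def rayPoint (θ r : ℝ) : ℂ := (r : ℂ) * Complex.exp (θ * Complex.I)

/-- The integrand of `∫ f(z) (z - A)⁻¹ dz` along the outgoing ray `r ↦ r e^{iθ}`, `r > 0`. -/
def rayIntegrand (A : X →ₗ.[ℂ] X) (f : ℂ → ℂ) (θ r : ℝ) : X →L[ℂ] X :=
  (f (rayPoint θ r) * Complex.exp (θ * Complex.I)) • resolventOp A (rayPoint θ r)

/-- Absolute convergence of the integral `∫ f(z) (z - A)⁻¹ dz` over the path `Γ_θ`. -/
def ContourIntegrable (A : X →ₗ.[ℂ] X) (f : ℂ → ℂ) (θ : ℝ) : Prop :=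
  IntegrableOn (rayIntegrand A f θ) (Ioi 0) ∧ IntegrableOn (rayIntegrand A f (-θ)) (Ioi 0)

/-- The operator `f(A) = (2πi)⁻¹ ∫_{Γ_θ} f(z) (z - A)⁻¹ dz`, where the path `Γ_θ` consists of the
rays of arguments `-θ` (outgoing) and `θ` (incoming), so that the sector lies on its left. -/
def contourOp (A : X →ₗ.[ℂ] X) (f : ℂ → ℂ) (θ : ℝ) : X →L[ℂ] X :=
  (2 * Real.pi * Complex.I : ℂ)⁻¹ •
    ((∫ r in Ioi (0 : ℝ), rayIntegrand A f (-θ) r) - ∫ r in Ioi (0 : ℝ), rayIntegrand A f θ r)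

/-- The function `g_{α,t}(z) = e^{-t z^α}` (principal branch). -/
def expFun (α : ℝ) (t z : ℂ) : ℂ := Complex.exp (-t * z ^ (α : ℂ))

/-- The upper bound for the angles of the paths that are admissible for `g_{α,t}`. -/
def angleBound (α : ℝ) (t : ℂ) : ℝ := min Real.pi ((Real.pi - 2 * |t.arg|) / (2 * α))

/-- The operator `𝒯_α(t) = (2πi)⁻¹ ∫_{Γ_θ} e^{-t z^α} (z - A)⁻¹ dz`, with `θ` the midpoint of the
interval of admissible angles `ω < θ < angleBound α t`. -/
def fracSemigroup (A : X →ₗ.[ℂ] X) (ω α : ℝ) (t : ℂ) : X →L[ℂ] X :=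
  contourOp A (expFun α t) ((ω + angleBound α t) / 2)

/-- The exponent `n` of the regularizer `(1 + z)⁻ⁿ` of `z^α`. -/
def regExponent (α : ℝ) : ℕ := ⌈α⌉₊ + 1

/-- The regularized function `z^α (1 + z)⁻ⁿ`, `n = regExponent α`. -/
def regPow (α : ℝ) (z : ℂ) : ℂ := z ^ (α : ℂ) * ((1 + z) ^ regExponent α)⁻¹

/-- The operator `(1 + A)⁻¹`. -/
def invOneAdd (A : X →ₗ.[ℂ] X) : X →L[ℂ] X := -resolventOp A (-1)

/-- The graph of `A^α`: the pairs `(x, y)` with `(1 + A)⁻ⁿ y = (z^α (1 + z)⁻ⁿ)(A) x`. -/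
def fracPowerGraph (A : X →ₗ.[ℂ] X) (ω α : ℝ) : Submodule ℂ (X × X) where
  carrier := {p | (invOneAdd A ^ regExponent α) p.2 =
    contourOp A (regPow α) ((ω + Real.pi) / 2) p.1}
  add_mem' := by
    intro p q hp hq
    simp only [mem_ofPred_eq, Prod.fst_add, Prod.snd_add, map_add] at *
    rw [hp, hq]
  zero_mem' := by simp
  smul_mem' := by
    intro c p hp
    simp only [mem_ofPred_eq, Prod.smul_fst, Prod.smul_snd, map_smul] at *
    rw [hp]

/-- The fractional power `A^α = (1 + A)ⁿ (z^α (1 + z)⁻ⁿ)(A)`, `α > 0`, of the (regularized)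
functional calculus of an operator `A ∈ Θ_ω^γ`, with its natural domain
`{x | (z^α (1 + z)⁻ⁿ)(A) x ∈ D(Aⁿ)}`. -/
def fracPower (A : X →ₗ.[ℂ] X) (ω α : ℝ) : X →ₗ.[ℂ] X :=
  (fracPowerGraph A ω α).toLinearPMap

theorem graph_fracPower {A : X →ₗ.[ℂ] X} (h : (-1 : ℂ) ∈ resolventSet A) (ω α : ℝ) :
    (fracPower A ω α).graph = fracPowerGraph A ω α := by
  refine Submodule.toLinearPMap_graph_eq _ ?_
  rintro ⟨x, y⟩ hp hx
  have hx' : x = 0 := hx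
  have hp' : (invOneAdd A ^ regExponent α) y =
    contourOp A (regPow α) ((ω + Real.pi) / 2) x := hp
  rw [hx', map_zero] at hp'
  have hinj : Function.Injective (invOneAdd A) := by
    intro a b hab
    apply resolventOp_injective h
    simpa [invOneAdd] using hab
  have hn : ∀ n : ℕ, (invOneAdd A ^ n) y = 0 → y = 0 := by
    intro n
    induction n with
    | zero => intro h0; simpa using h0
    | succ k ih =>
      intro h0
      apply ih
      apply hinj
      rw [map_zero, ← h0, pow_succ']
      rfl
  exact hn _ hp'

/-- `{S(t) : t ∈ S_μ^0}` is an analytic semigroup of growth order `κ`. -/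
structure IsAnalyticSemigroupOfGrowthOrder (S : ℂ → X →L[ℂ] X) (μ κ : ℝ) : Prop where
  angle_pos : 0 < μ
  angle_lt : μ < Real.pi / 2
  order_pos : 0 < κ
  map_add : ∀ t ∈ openSector μ, ∀ s ∈ openSector μ, S (t + s) = S t ∘L S s
  analytic : AnalyticOnNhd ℂ S (openSector μ)
  growth : ∃ C : ℝ, 0 < C ∧ ∀ t : ℝ, 0 < t → ‖S (t : ℂ)‖ ≤ C * t ^ (-κ)
  injective : ∀ t ∈ openSector μ, ∀ x : X, S t x = 0 → x = 0

/-- The continuity set of the family `S`. -/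
def continuitySet (S : ℂ → X →L[ℂ] X) : Set X :=
  {x | Tendsto (fun t : ℝ => S (t : ℂ) x) (𝓝[>] 0) (𝓝 x)}

/-- `u` is a classical solution of `u_t = -φ(t) B u` on `(0, T)`: it is continuously
differentiable on `(0, T)`, takes its values in `D(B)` and satisfies the equation there. -/
def IsClassicalSolution (B : X →ₗ.[ℂ] X) (φ : ℝ → ℝ) (T : ℝ) (u : ℝ → X) : Prop :=
  ContDiffOn ℝ 1 u (Ioo 0 T) ∧
    ∀ t ∈ Ioo 0 T, ∃ h : u t ∈ B.domain, HasDerivAt u (-((φ t : ℂ) • B ⟨u t, h⟩)) t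

/-- The initial condition `u(0) = u₀`, in the norm of `X`. -/
def HasStrongInitialValue (u : ℝ → X) (u₀ : X) : Prop :=
  Tendsto u (𝓝[>] 0) (𝓝 u₀)

/-- The initial condition `u(0) = u₀`, in the extrapolation norms `x ↦ ‖(z - A)⁻¹ x‖`, `z ∈ ρ(A)`
(which are all equivalent to each other). -/
def HasInitialValue (A : X →ₗ.[ℂ] X) (u : ℝ → X) (u₀ : X) : Prop :=
  ∀ z ∈ resolventSet A,
    Tendsto (fun t => resolventOp A z (u t)) (𝓝[>] 0) (𝓝 (resolventOp A z u₀))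

/-- `S` is the solution operator of the problem `u_t = -φ(t) A^α u` on `(0, T)`, `u(0) = u₀`: for
every `u₀ ∈ X`, the function `t ↦ S(t) u₀` is the one and only classical solution. -/
def IsSolutionOperator (A : X →ₗ.[ℂ] X) (ω α : ℝ) (φ : ℝ → ℝ) (T : ℝ)
    (S : ℝ → X →L[ℂ] X) : Prop :=
  ∀ (u₀ : X) (u : ℝ → X),
    (IsClassicalSolution (fracPower A ω α) φ T u ∧ HasInitialValue A u u₀) ↔
      ∀ t ∈ Ioo 0 T, u t = S t u₀

end AlmostSectorial

end

open Set Filter Topology MeasureTheory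

noncomputable section

namespace AlmostSectorial

section

/-! ### Integrals over rays -/

/-! Functions that are holomorphic in a sector, bounded at 0 and O(1/|z|) at infinity
(`SectorDecay`) can be inserted into f(A) = (2πi)⁻¹∫ f(z)(z-A)⁻¹dz. As ‖(z-A)⁻¹‖ ≤ C|z|^γ with -1 <
γ < 0, the integrand is O(|z|^γ) at 0 and O(|z|^(γ-1)) at infinity, so the integral converges
absolutely, and Cauchy's theorem in the variable log z (`RayDecay.rayIntegral_eq`) makes it
independent of the angle. The calculus rests on Cauchy's formula for Γ_θ, on the identity
`contourOp_inv_sub`, which recovers R = (-1-A)⁻¹, and on multiplicativity, `contourOp_mul`, which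
follows from the resolvent identity, Fubini and Cauchy's formula.

For |arg t| + αθ < π/2 the function e^{-tz^α} decays like exp(-c|z|^α) on the sector of half-angle
θ. Differentiation under the integral gives analyticity of 𝒯_α with derivative -(z^α e^{-tz^α})(A).
Multiplication by the regularizer (1+A)⁻ⁿ identifies this operator as -A^α𝒯_α(t) and shows that
𝒯_α(t) commutes with A^α on D(A^α) (`mem_graph`, `contourOp_fracPower`). The growth order is read
off a Gamma integral.

The operators 𝒯_α(t) may blow up as t → 0, but R𝒯_α(t) → R in operator norm, and R is injective.
This substitute for strong continuity settles the semigroup law, the injectivity of 𝒯_α(t), the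
initial condition and uniqueness: limits at t = 0 are taken after applying R, and R is cancelled at
the end.

With Φ(t) = ∫₀ᵗφ, the chain rule turns 𝒯_α into a solution 𝒯_α(Φ(t))u₀. Conversely, for a solution u
the function s ↦ 𝒯_α(Φ(t)-Φ(s))u(s) is constant on (0,t), and its two end limits give u(t) =
𝒯_α(Φ(t))u₀. Since Φ maps the right neighbourhoods of 0 onto right neighbourhoods of 0, u(t) → u₀ in
norm exactly when u₀ lies in the continuity set. -/

/-- The union of the rays of the angles `a ≤ θ ≤ b`, without the vertex. -/
def rays (a b : ℝ) : Set ℂ := {z | ∃ θ ∈ Icc a b, ∃ r : ℝ, 0 < r ∧ rayPoint θ r = z}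

theorem rayPoint_mem_rays {a b θ r : ℝ} (hθ : θ ∈ Icc a b) (hr : 0 < r) :
    rayPoint θ r ∈ rays a b := ⟨θ, hθ, r, hr, rfl⟩

theorem rays_mono {a b a' b' : ℝ} (ha : a' ≤ a) (hb : b ≤ b') : rays a b ⊆ rays a' b' := by
  rintro z ⟨θ, hθ, r, hr, rfl⟩
  exact rayPoint_mem_rays ⟨ha.trans hθ.1, hθ.2.trans hb⟩ hr

@[simp]
theorem norm_rayPoint (θ r : ℝ) : ‖rayPoint θ r‖ = |r| := by
  simp [rayPoint, Complex.norm_exp_ofReal_mul_I]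

theorem rayPoint_ne_zero {θ r : ℝ} (hr : 0 < r) : rayPoint θ r ≠ 0 := by
  rw [← norm_pos_iff, norm_rayPoint]
  exact abs_pos.2 hr.ne'

theorem ne_zero_of_mem_rays {a b : ℝ} {z : ℂ} (hz : z ∈ rays a b) : z ≠ 0 := by
  obtain ⟨θ, -, r, hr, rfl⟩ := hz
  exact rayPoint_ne_zero hr

theorem continuous_rayPoint (θ : ℝ) : Continuous (rayPoint θ) := by
  unfold rayPoint
  fun_prop

theorem tendsto_rayPoint_zero {a b θ : ℝ} (hθ : θ ∈ Icc a b) :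
    Tendsto (rayPoint θ) (𝓝[>] 0) (𝓝[rays a b] 0) := by
  refine tendsto_nhdsWithin_iff.2 ⟨?_, ?_⟩
  · have h := (continuous_rayPoint θ).tendsto 0
    rw [show rayPoint θ 0 = 0 by simp [rayPoint]] at h
    exact h.mono_left nhdsWithin_le_nhds
  · filter_upwards [self_mem_nhdsWithin] with r hr using rayPoint_mem_rays hθ hr

theorem tendsto_rayPoint_atTop {a b θ : ℝ} (hθ : θ ∈ Icc a b) :
    Tendsto (rayPoint θ) atTop (Bornology.cobounded ℂ ⊓ 𝓟 (rays a b)) := by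
  refine tendsto_inf.2 ⟨?_, tendsto_principal.2 ?_⟩
  · rw [← tendsto_norm_atTop_iff_cobounded]
    simpa using tendsto_abs_atTop_atTop
  · filter_upwards [eventually_gt_atTop 0] with r hr using rayPoint_mem_rays hθ hr

/-- The function `F` is holomorphic on `S`, and it is `O(‖z‖⁻ᵖ)`, `p < 1`, at the origin, and
`O(‖z‖^(-q))`, `q > 1`, at infinity. -/
structure RayDecay {E : Type*} [NormedAddCommGroup E] [NormedSpace ℂ E] (S : Set ℂ) (F : ℂ → E) :
    Prop where
  diff : ∀ z ∈ S, DifferentiableAt ℂ F z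
  zero : ∃ p : ℝ, p < 1 ∧ F =O[𝓝[S] 0] fun z => ‖z‖ ^ (-p)
  infty : ∃ q : ℝ, 1 < q ∧ F =O[Bornology.cobounded ℂ ⊓ 𝓟 S] fun z => ‖z‖ ^ (-q)

theorem isBigO_rayPoint_zero {E : Type*} [NormedAddCommGroup E] {a b θ p : ℝ} {F : ℂ → E}
    (h : F =O[𝓝[rays a b] 0] fun z => ‖z‖ ^ p) (hθ : θ ∈ Icc a b) :
    (fun r => F (rayPoint θ r)) =O[𝓝[>] 0] fun r : ℝ => r ^ p := by
  refine (h.comp_tendsto (tendsto_rayPoint_zero hθ)).congr' EventuallyEq.rfl ?_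
  filter_upwards [self_mem_nhdsWithin] with r hr
  simp [abs_of_pos (mem_Ioi.1 hr)]

theorem isBigO_rayPoint_atTop {E : Type*} [NormedAddCommGroup E] {a b θ p : ℝ} {F : ℂ → E}
    (h : F =O[Bornology.cobounded ℂ ⊓ 𝓟 (rays a b)] fun z => ‖z‖ ^ p) (hθ : θ ∈ Icc a b) :
    (fun r => F (rayPoint θ r)) =O[atTop] fun r : ℝ => r ^ p := by
  refine (h.comp_tendsto (tendsto_rayPoint_atTop hθ)).congr' EventuallyEq.rfl ?_
  filter_upwards [eventually_gt_atTop 0] with r hr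
  simp [abs_of_pos hr]

section RayIntegral

variable {E : Type*} [NormedAddCommGroup E] [NormedSpace ℂ E]

theorem RayDecay.mono {S S' : Set ℂ} {F : ℂ → E} (h : RayDecay S F) (hS : S' ⊆ S) :
    RayDecay S' F where
  diff z hz := h.diff z (hS hz)
  zero := h.zero.imp fun _ hp => ⟨hp.1, hp.2.mono (nhdsWithin_mono _ hS)⟩
  infty := h.infty.imp fun _ hq => ⟨hq.1, hq.2.mono (inf_le_inf_left _ (principal_mono.2 hS))⟩

theorem continuousOn_comp_rayPoint {a b θ : ℝ} {F : ℂ → E}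
    (h : ∀ z ∈ rays a b, DifferentiableAt ℂ F z) (hθ : θ ∈ Icc a b) :
    ContinuousOn (fun r => F (rayPoint θ r)) (Ioi 0) := fun _ hr =>
  ((h _ (rayPoint_mem_rays hθ hr)).continuousAt.comp
    (continuous_rayPoint θ).continuousAt).continuousWithinAt

/-- A continuous function on `(0, ∞)` that is `O(r⁻ᵖ)` at `0`, `p < 1`, and `O(r^(-q))` at
infinity, `q > 1`, is integrable. -/
theorem integrableOn_Ioi_of_isBigO_rpow {f : ℝ → E} {p q : ℝ} (hf : ContinuousOn f (Ioi 0))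
    (hp : p < 1) (h0 : f =O[𝓝[>] 0] fun r => r ^ (-p)) (hq : 1 < q)
    (h1 : f =O[atTop] fun r => r ^ (-q)) : IntegrableOn f (Ioi 0) := by
  have h := mellinConvergent_of_isBigO_rpow (s := 1) (hf.locallyIntegrableOn measurableSet_Ioi)
    h1 (by simpa using hq) h0 (by simpa using hp)
  simpa [MellinConvergent] using h

theorem RayDecay.integrableOn {a b θ : ℝ} {F : ℂ → E} (h : RayDecay (rays a b) F)
    (hθ : θ ∈ Icc a b) : IntegrableOn (fun r => F (rayPoint θ r)) (Ioi 0) := by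
  obtain ⟨p, hp, h0⟩ := h.zero
  obtain ⟨q, hq, h1⟩ := h.infty
  exact integrableOn_Ioi_of_isBigO_rpow (continuousOn_comp_rayPoint h.diff hθ) hp
    (isBigO_rayPoint_zero h0 hθ) hq (isBigO_rayPoint_atTop h1 hθ)

/-- The integral of `F` over the outgoing ray of angle `θ`. -/
def rayIntegral (F : ℂ → E) (θ : ℝ) : E :=
  ∫ r in Ioi (0 : ℝ), Complex.exp (θ * Complex.I) • F (rayPoint θ r)

theorem RayDecay.integrableOn_smul {a b θ : ℝ} {F : ℂ → E} (h : RayDecay (rays a b) F)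
    (hθ : θ ∈ Icc a b) :
    IntegrableOn (fun r => Complex.exp (θ * Complex.I) • F (rayPoint θ r)) (Ioi 0) :=
  (h.integrableOn hθ).smul _

theorem exp_add_mul_I (x y : ℝ) : Complex.exp (x + y * Complex.I) = rayPoint y (Real.exp x) := by
  simp [rayPoint, Complex.exp_add]

theorem image_exp_univ : Real.exp '' univ = Ioi 0 := by
  rw [image_univ, Real.range_exp]

/-- The substitution r = e^x turns the ray of angle θ into the horizontal line Im w = θ, w = log z,
and dz = e^w dw. -/
theorem integrable_exp_smul_iff (F : ℂ → E) (θ : ℝ) :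
    IntegrableOn (fun r => Complex.exp (θ * Complex.I) • F (rayPoint θ r)) (Ioi 0) ↔
    Integrable fun x : ℝ => Complex.exp (x + θ * Complex.I) •
      F (Complex.exp (x + θ * Complex.I)) := by
  rw [← image_exp_univ, integrableOn_image_iff_integrableOn_abs_deriv_smul MeasurableSet.univ
    (fun x _ => (Real.hasDerivAt_exp x).hasDerivWithinAt) Real.exp_injective.injOn,
    integrableOn_univ]
  refine iff_of_eq (congrArg (fun f => Integrable f volume) (funext fun x => ?_))
  rw [exp_add_mul_I, abs_of_pos (Real.exp_pos x), rayPoint, ← smul_assoc]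
  simp

theorem rayIntegral_eq_integral_exp (F : ℂ → E) (θ : ℝ) :
    rayIntegral F θ = ∫ x : ℝ, Complex.exp (x + θ * Complex.I) •
      F (Complex.exp (x + θ * Complex.I)) := by
  rw [rayIntegral, ← image_exp_univ, integral_image_eq_integral_abs_deriv_smul MeasurableSet.univ
    (fun x _ => (Real.hasDerivAt_exp x).hasDerivWithinAt) Real.exp_injective.injOn,
    setIntegral_univ]
  refine integral_congr_ae (Eventually.of_forall fun x => ?_)
  simp only
  rw [exp_add_mul_I, abs_of_pos (Real.exp_pos x), rayPoint, ← smul_assoc]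
  simp

/-- In the variable log z an arc is a vertical edge at abscissa s·m. There |dz| contributes e^{sm}
and F at most C e^{m-sm}, so the product is at most C e^m, which tends to 0 with m → -∞. The edges
at -N and at N are reached with m = (1-p)(-N) and m = (1-q)N and the reciprocal factor for s. -/
theorem tendsto_integral_arc {a b s : ℝ} {F : ℂ → E} {l : Filter ℝ} {m : ℝ → ℝ}
    (hab : a ≤ b) (C : ℝ) (hm : Tendsto m l atBot) (hs : ∀ᶠ N in l, ∀ θ ∈ Icc a b,
      ‖F (rayPoint θ (Real.exp (s * m N)))‖ ≤ C * Real.exp (m N - s * m N)) :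
    Tendsto (fun N => ∫ y in a..b, Complex.exp ((s * m N : ℝ) + y * Complex.I) •
      F (Complex.exp ((s * m N : ℝ) + y * Complex.I))) l (𝓝 0) := by
  have h0 : Tendsto (fun N => C * Real.exp (m N) * |b - a|) l (𝓝 0) := by
    have := ((Real.tendsto_exp_atBot.comp hm).const_mul C).mul_const |b - a|
    simpa using this
  refine squeeze_zero_norm' ?_ h0
  filter_upwards [hs] with N hN
  refine intervalIntegral.norm_integral_le_of_norm_le_const fun y hy => ?_
  rw [uIoc_of_le hab] at hy
  rw [exp_add_mul_I, norm_smul, norm_rayPoint, abs_of_pos (Real.exp_pos _)]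
  calc _ ≤ Real.exp (s * m N) * (C * Real.exp (m N - s * m N)) := by
        gcongr
        exact hN y (Ioc_subset_Icc_self hy)
    _ = C * Real.exp (m N) := by
        rw [Real.exp_sub]
        field_simp

theorem RayDecay.exists_bound_zero {a b : ℝ} {F : ℂ → E} (h : RayDecay (rays a b) F) :
    ∃ C p : ℝ, p < 1 ∧ ∀ᶠ x in atBot, ∀ θ ∈ Icc a b,
      ‖F (rayPoint θ (Real.exp x))‖ ≤ C * Real.exp (-p * x) := by
  obtain ⟨p, hp, h0⟩ := h.zero
  obtain ⟨C, hC⟩ := h0.bound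
  refine ⟨C, p, hp, ?_⟩
  obtain ⟨ε, hε, hb⟩ := Metric.mem_nhdsWithin_iff.1 hC
  have he : ∀ᶠ x in atBot, Real.exp x < ε :=
    Real.tendsto_exp_atBot.eventually (gt_mem_nhds hε)
  filter_upwards [he] with x hx θ hθ
  have := hb ⟨?_, rayPoint_mem_rays hθ (Real.exp_pos x)⟩
  · simpa [← Real.exp_mul, mul_comm, abs_of_pos (Real.rpow_pos_of_pos (Real.exp_pos x) (-p))]
      using this
  · simpa using hx

theorem RayDecay.exists_bound_infty {a b : ℝ} {F : ℂ → E} (h : RayDecay (rays a b) F) :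
    ∃ C q : ℝ, 1 < q ∧ ∀ᶠ x in atTop, ∀ θ ∈ Icc a b,
      ‖F (rayPoint θ (Real.exp x))‖ ≤ C * Real.exp (-q * x) := by
  obtain ⟨q, hq, h0⟩ := h.infty
  obtain ⟨C, hC⟩ := h0.bound
  refine ⟨C, q, hq, ?_⟩
  rw [eventually_inf_principal, ← comap_norm_atTop, eventually_comap] at hC
  filter_upwards [Real.tendsto_exp_atTop.eventually hC] with x hx θ hθ
  have := hx (rayPoint θ (Real.exp x)) (by simp) (rayPoint_mem_rays hθ (Real.exp_pos x))
  simpa [← Real.exp_mul, mul_comm, abs_of_pos (Real.rpow_pos_of_pos (Real.exp_pos x) (-q))]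
    using this

/-- Under z = e^w the region between the two rays becomes a horizontal strip. Cauchy's theorem holds
on each rectangle [-N,N] × [a,b], and the decay at 0 and at infinity kills the vertical edges as N →
∞. -/
theorem RayDecay.rayIntegral_eq {a b : ℝ} {F : ℂ → E} (h : RayDecay (rays a b) F) (hab : a ≤ b) :
    rayIntegral F a = rayIntegral F b := by
  set H : ℂ → E := fun w => Complex.exp w • F (Complex.exp w) with hH
  have hint : ∀ θ ∈ Icc a b, Tendsto
      (fun N : ℝ => ∫ x in (-N)..N, H (x + θ * Complex.I)) atTop (𝓝 (rayIntegral F θ)) := by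
    intro θ hθ
    rw [rayIntegral_eq_integral_exp]
    exact intervalIntegral_tendsto_integral
      ((integrable_exp_smul_iff F θ).1 (h.integrableOn_smul hθ)) tendsto_neg_atTop_atBot tendsto_id
  have hleft : Tendsto (fun N : ℝ => ∫ y in a..b, H ((-N : ℝ) + y * Complex.I)) atTop (𝓝 0) := by
    obtain ⟨C, p, hp, hb⟩ := h.exists_bound_zero
    have hp' : 0 < 1 - p := by linarith
    have := tendsto_integral_arc (s := (1 - p)⁻¹) (m := fun N => (1 - p) * -N) (F := F)
      (l := atTop) hab C (tendsto_neg_atTop_atBot.const_mul_atBot hp') ?_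
    · simpa [hH, inv_mul_cancel_left₀ hp'.ne'] using this
    · filter_upwards [tendsto_neg_atTop_atBot.eventually hb] with N hN θ hθ
      rw [inv_mul_cancel_left₀ hp'.ne']
      convert hN θ hθ using 3
      ring
  have hright : Tendsto (fun N : ℝ => ∫ y in a..b, H (N + y * Complex.I)) atTop (𝓝 0) := by
    obtain ⟨C, q, hq, hb⟩ := h.exists_bound_infty
    have hq' : 1 - q < 0 := by linarith
    have := tendsto_integral_arc (s := (1 - q)⁻¹) (m := fun N => (1 - q) * N) (F := F)
      (l := atTop) hab C (tendsto_id.const_mul_atTop_of_neg hq') ?_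
    · simpa [hH, inv_mul_cancel_left₀ hq'.ne] using this
    · filter_upwards [hb] with N hN θ hθ
      rw [inv_mul_cancel_left₀ hq'.ne]
      convert hN θ hθ using 3
      ring
  have hrect : ∀ N : ℝ, (∫ x in (-N)..N, H (x + a * Complex.I)) -
      (∫ x in (-N)..N, H (x + b * Complex.I)) + Complex.I • (∫ y in a..b, H (N + y * Complex.I)) -
      Complex.I • (∫ y in a..b, H ((-N : ℝ) + y * Complex.I)) = 0 := by
    intro N
    have := Complex.integral_boundary_rect_eq_zero_of_differentiableOn H
      ((-N : ℝ) + a * Complex.I) (N + b * Complex.I) ?_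
    · simpa using this
    · intro w hw
      have hw2 : w.im ∈ Icc a b := by
        have := hw.2
        simpa [uIcc_of_le hab] using this
      have hF : DifferentiableAt ℂ F (Complex.exp w) := by
        refine h.diff _ ⟨w.im, hw2, Real.exp w.re, Real.exp_pos _, ?_⟩
        rw [← exp_add_mul_I, Complex.re_add_im]
      exact (Complex.differentiableAt_exp.smul
        (hF.comp w Complex.differentiableAt_exp)).differentiableWithinAt
  have hlim := (((hint a ⟨le_rfl, hab⟩).sub (hint b ⟨hab, le_rfl⟩)).add
    (hright.const_smul Complex.I)).sub (hleft.const_smul Complex.I)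
  simp only [hrect, smul_zero, add_zero, sub_zero] at hlim
  exact sub_eq_zero.1 (tendsto_nhds_unique hlim tendsto_const_nhds)

/-- The integral of `F` over the path `Γ_θ`. -/
def contourIntegral (F : ℂ → E) (θ : ℝ) : E := rayIntegral F (-θ) - rayIntegral F θ

theorem RayDecay.contourIntegral_eq_zero {θ : ℝ} {F : ℂ → E} (h : RayDecay (rays (-θ) θ) F)
    (hθ : 0 ≤ θ) : contourIntegral F θ = 0 :=
  sub_eq_zero.2 (h.rayIntegral_eq (by linarith))

theorem RayDecay.contourIntegral_eq {θ θ' : ℝ} {F : ℂ → E} (h : RayDecay (rays θ θ') F)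
    (h' : RayDecay (rays (-θ') (-θ)) F) (hθ : θ ≤ θ') :
    contourIntegral F θ = contourIntegral F θ' := by
  rw [contourIntegral, contourIntegral, h.rayIntegral_eq hθ, h'.rayIntegral_eq (by linarith)]

end RayIntegral

end

section

/-! ### Sectors in terms of rays -/

theorem rayPoint_eq_cos_add_sin (θ r : ℝ) :
    rayPoint θ r = r * (Complex.cos θ + Complex.sin θ * Complex.I) := by
  rw [rayPoint, Complex.exp_mul_I]

theorem arg_rayPoint {θ r : ℝ} (hθ : θ ∈ Ioc (-Real.pi) Real.pi) (hr : 0 < r) :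
    (rayPoint θ r).arg = θ := by
  rw [rayPoint_eq_cos_add_sin, Complex.arg_mul_cos_add_sin_mul_I hr hθ]

theorem abs_arg_rayPoint {θ r : ℝ} (hθ : |θ| ≤ Real.pi) (hr : 0 < r) :
    |(rayPoint θ r).arg| = |θ| := by
  rcases (abs_le.1 hθ).1.eq_or_lt with h | h
  -- The angles -π and π name the same ray, on which `arg` takes the value π.
  · rw [← h, show rayPoint (-Real.pi) r = rayPoint Real.pi r by simp [rayPoint_eq_cos_add_sin],
      arg_rayPoint ⟨by linarith [Real.pi_pos], le_rfl⟩ hr, abs_neg]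
  · rw [arg_rayPoint ⟨h, (abs_le.1 hθ).2⟩ hr]

theorem zero_notMem_rays {a b : ℝ} : (0 : ℂ) ∉ rays a b := fun h => ne_zero_of_mem_rays h rfl

theorem rayPoint_arg (z : ℂ) : rayPoint z.arg ‖z‖ = z := Complex.norm_mul_exp_arg_mul_I z

theorem rayPoint_mem_openSector {μ θ r : ℝ} (hμ : μ ≤ Real.pi) (hθ : |θ| < μ) (hr : 0 < r) :
    rayPoint θ r ∈ openSector μ :=
  ⟨rayPoint_ne_zero hr, by rwa [abs_arg_rayPoint (hθ.le.trans hμ) hr]⟩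

theorem openSector_subset_rays (μ : ℝ) : openSector μ ⊆ rays (-μ) μ := fun z hz =>
  ⟨z.arg, abs_le.1 hz.2.le, ‖z‖, norm_pos_iff.2 hz.1, rayPoint_arg z⟩

theorem isOpen_openSector {μ : ℝ} (hμ : μ ≤ Real.pi) : IsOpen (openSector μ) := by
  rw [isOpen_iff_mem_nhds]
  intro z hz
  have hs : z ∈ Complex.slitPlane := by
    rw [Complex.mem_slitPlane_iff_arg]
    exact ⟨fun h => absurd hz.2 (by rw [h, abs_of_pos Real.pi_pos]; linarith), hz.1⟩
  have h1 : ∀ᶠ w in 𝓝 z, |w.arg| < μ :=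
    (Complex.continuousAt_arg hs).abs.eventually (gt_mem_nhds hz.2)
  filter_upwards [h1, isOpen_ne.mem_nhds hz.1] with w hw hw0 using ⟨hw0, hw⟩

theorem rays_mem_nhds {θ : ℝ} (hθ : θ ≤ Real.pi) {ψ r : ℝ} (hψ : |ψ| < θ) (hr : 0 < r) :
    rays (-θ) θ ∈ 𝓝 (rayPoint ψ r) :=
  mem_of_superset ((isOpen_openSector hθ).mem_nhds (rayPoint_mem_openSector hθ hψ hr))
    (openSector_subset_rays θ)

theorem mem_slitPlane_of_mem_rays {θ : ℝ} (hθ : θ < Real.pi) {z : ℂ} (hz : z ∈ rays (-θ) θ) :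
    z ∈ Complex.slitPlane := by
  obtain ⟨ψ, hψ, r, hr, rfl⟩ := hz
  rw [Complex.mem_slitPlane_iff_arg, arg_rayPoint ⟨by linarith [hψ.1], by linarith [hψ.2]⟩ hr]
  exact ⟨by linarith [hψ.2], rayPoint_ne_zero hr⟩

/-- Two lines through the origin with different directions meet only at the origin. -/
theorem rayPoint_ne_real_mul {χ ψ r ρ c : ℝ} (h : Real.sin (χ - ψ) ≠ 0) (hr : 0 < r) :
    rayPoint χ r ≠ c * rayPoint ψ ρ := by
  intro he
  have h1 : (r : ℂ) * Complex.exp ((χ - ψ : ℝ) * Complex.I) = (c * ρ : ℝ) := by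
    have := congrArg (fun w => w * Complex.exp (-(ψ * Complex.I))) he
    simp only [rayPoint, mul_assoc, ← Complex.exp_add] at this
    rw [add_neg_cancel, Complex.exp_zero] at this
    push_cast
    rw [sub_mul, sub_eq_add_neg, this]
    ring
  have h2 := congrArg Complex.im h1
  rw [Complex.exp_mul_I, ← Complex.ofReal_cos, ← Complex.ofReal_sin, Complex.ofReal_im,
    Complex.im_ofReal_mul] at h2
  simp only [Complex.add_im, Complex.ofReal_im, Complex.mul_im, Complex.I_im,
    Complex.I_re, Complex.ofReal_re, mul_one, mul_zero, add_zero, zero_add, mul_eq_zero] at h2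
  exact h2.elim hr.ne' h

/-! ### Cauchy's integral formula for the path `Γ_θ` -/

/-- The function `f` is holomorphic on `S`, bounded at the origin, and `O(‖z‖⁻¹)` at infinity. -/
structure SectorDecay (S : Set ℂ) (f : ℂ → ℂ) : Prop where
  diff : ∀ z ∈ S, DifferentiableAt ℂ f z
  zero : f =O[𝓝[S] 0] fun _ => (1 : ℝ)
  infty : f =O[Bornology.cobounded ℂ ⊓ 𝓟 S] fun z => ‖z‖ ^ (-1 : ℝ)

theorem SectorDecay.mono {S S' : Set ℂ} {f : ℂ → ℂ} (h : SectorDecay S f) (hS : S' ⊆ S) :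
    SectorDecay S' f where
  diff z hz := h.diff z (hS hz)
  zero := h.zero.mono (nhdsWithin_mono _ hS)
  infty := h.infty.mono (inf_le_inf_left _ (principal_mono.2 hS))

theorem eventually_ne_zero_cobounded (S : Set ℂ) :
    ∀ᶠ z in Bornology.cobounded ℂ ⊓ 𝓟 S, 0 < ‖z‖ := by
  have := (tendsto_norm_cobounded_atTop (E := ℂ)).eventually (eventually_gt_atTop 0)
  exact this.filter_mono inf_le_left

theorem isBigO_norm_rpow_cobounded {p q : ℝ} (h : p ≤ q) (S : Set ℂ) :
    (fun z : ℂ => ‖z‖ ^ p) =O[Bornology.cobounded ℂ ⊓ 𝓟 S] fun z => ‖z‖ ^ q := by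
  refine Asymptotics.IsBigO.of_bound 1 ?_
  have := (tendsto_norm_cobounded_atTop (E := ℂ)).eventually (eventually_ge_atTop 1)
  filter_upwards [this.filter_mono inf_le_left] with z hz
  rw [one_mul, Real.norm_of_nonneg (by positivity), Real.norm_of_nonneg (by positivity)]
  exact Real.rpow_le_rpow_of_exponent_le hz h

theorem isBigO_norm_rpow_zero {p q : ℝ} (h : p ≤ q) {S : Set ℂ} (hS : (0 : ℂ) ∉ S) :
    (fun z : ℂ => ‖z‖ ^ q) =O[𝓝[S] 0] fun z => ‖z‖ ^ p := by
  refine Asymptotics.IsBigO.of_bound 1 ?_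
  filter_upwards [self_mem_nhdsWithin, nhdsWithin_le_nhds (Metric.ball_mem_nhds 0 one_pos)]
    with z hz hz1
  have hz0 : 0 < ‖z‖ := norm_pos_iff.2 (ne_of_mem_of_not_mem hz hS)
  rw [one_mul, Real.norm_of_nonneg (by positivity), Real.norm_of_nonneg (by positivity)]
  exact Real.rpow_le_rpow_of_exponent_ge hz0 (mem_ball_zero_iff.1 hz1).le h

theorem isBigO_mul_cobounded {S : Set ℂ} {E : Type*} [NormedAddCommGroup E] [NormedSpace ℂ E]
    {f : ℂ → ℂ} {g : ℂ → E} {p q : ℝ}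
    (hf : f =O[Bornology.cobounded ℂ ⊓ 𝓟 S] fun z => ‖z‖ ^ p)
    (hg : g =O[Bornology.cobounded ℂ ⊓ 𝓟 S] fun z => ‖z‖ ^ q) :
    (fun z => f z • g z) =O[Bornology.cobounded ℂ ⊓ 𝓟 S] fun z => ‖z‖ ^ (p + q) := by
  refine (hf.smul hg).congr' EventuallyEq.rfl ?_
  filter_upwards [eventually_ne_zero_cobounded S] with z hz
  rw [Real.rpow_add hz, smul_eq_mul]

theorem SectorDecay.mul {S : Set ℂ} {f g : ℂ → ℂ} (hf : SectorDecay S f) (hg : SectorDecay S g) :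
    SectorDecay S fun z => f z * g z where
  diff z hz := (hf.diff z hz).mul (hg.diff z hz)
  zero := by simpa using hf.zero.mul hg.zero
  infty := (isBigO_mul_cobounded hf.infty hg.infty).trans
    (isBigO_norm_rpow_cobounded (by norm_num) S)

/-- The bound O(1/|z|) of a single factor does not ensure integrability at infinity; the bound
O(1/|z|²) of a product does. -/
theorem SectorDecay.rayDecay_mul {S : Set ℂ} {f g : ℂ → ℂ} (hf : SectorDecay S f)
    (hg : SectorDecay S g) : RayDecay S fun z => f z * g z where
  diff z hz := (hf.diff z hz).mul (hg.diff z hz)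
  zero := ⟨0, by norm_num, by simpa using hf.zero.mul hg.zero⟩
  infty := ⟨2, by norm_num, by
    simpa [show (-1 : ℝ) + -1 = -2 by norm_num] using isBigO_mul_cobounded hf.infty hg.infty⟩

theorem RayDecay.const_mul {S : Set ℂ} {f : ℂ → ℂ} (hf : RayDecay S f) (c : ℂ) :
    RayDecay S fun z => c * f z where
  diff z hz := (hf.diff z hz).const_mul c
  zero := hf.zero.imp fun _ h => ⟨h.1, h.2.const_mul_left c⟩
  infty := hf.infty.imp fun _ h => ⟨h.1, h.2.const_mul_left c⟩

theorem SectorDecay.const_mul {S : Set ℂ} {f : ℂ → ℂ} (hf : SectorDecay S f) (c : ℂ) :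
    SectorDecay S fun z => c * f z where
  diff z hz := (hf.diff z hz).const_mul c
  zero := hf.zero.const_mul_left c
  infty := hf.infty.const_mul_left c

theorem sectorDecay_inv_sub {S : Set ℂ} {w : ℂ} (hw : w ≠ 0) (hS : w ∉ S) :
    SectorDecay S fun z => (w - z)⁻¹ where
  diff z hz := ((differentiableAt_const w).sub differentiableAt_id).inv
    (sub_ne_zero.2 (ne_of_mem_of_not_mem hz hS).symm)
  zero := by
    have h : Tendsto (fun z : ℂ => (w - z)⁻¹) (𝓝 0) (𝓝 (w - 0)⁻¹) :=
      (tendsto_const_nhds.sub tendsto_id).inv₀ (by simpa using hw)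
    exact (h.isBigO_one ℝ).mono nhdsWithin_le_nhds
  infty := by
    refine Asymptotics.IsBigO.of_bound 2 ?_
    have := (tendsto_norm_cobounded_atTop (E := ℂ)).eventually (eventually_ge_atTop (2 * ‖w‖))
    filter_upwards [this.filter_mono inf_le_left, eventually_ne_zero_cobounded S] with z hz hz0
    rw [Real.rpow_neg_one, norm_inv, norm_inv, norm_norm]
    have h1 : ‖z‖ / 2 ≤ ‖w - z‖ := by
      have := norm_sub_norm_le z w
      rw [norm_sub_rev] at this
      linarith
    calc ‖w - z‖⁻¹ ≤ (‖z‖ / 2)⁻¹ := inv_anti₀ (by positivity) h1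
      _ = 2 * ‖z‖⁻¹ := by rw [inv_div]; rfl

/-! ### Linearity of the path integrals -/

section Linear

variable {E : Type*} [NormedAddCommGroup E] [NormedSpace ℂ E]

theorem rayIntegral_congr {F G : ℂ → E} {θ : ℝ} (h : ∀ z ∈ rays θ θ, F z = G z) :
    rayIntegral F θ = rayIntegral G θ :=
  setIntegral_congr_fun measurableSet_Ioi fun r hr => by
    simp only [h _ (rayPoint_mem_rays ⟨le_rfl, le_rfl⟩ hr)]

theorem contourIntegral_congr {F G : ℂ → E} {θ : ℝ} (h : ∀ z ∈ rays θ θ, F z = G z)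
    (h' : ∀ z ∈ rays (-θ) (-θ), F z = G z) : contourIntegral F θ = contourIntegral G θ := by
  rw [contourIntegral, contourIntegral, rayIntegral_congr h, rayIntegral_congr h']

theorem rayIntegral_sub {F G : ℂ → E} {θ : ℝ} (hF : RayDecay (rays θ θ) F)
    (hG : RayDecay (rays θ θ) G) :
    rayIntegral (fun z => F z - G z) θ = rayIntegral F θ - rayIntegral G θ := by
  simp only [rayIntegral, smul_sub]
  exact integral_sub (hF.integrableOn_smul ⟨le_rfl, le_rfl⟩) (hG.integrableOn_smul ⟨le_rfl, le_rfl⟩)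

theorem contourIntegral_sub {F G : ℂ → E} {θ : ℝ} (hF : RayDecay (rays θ θ) F)
    (hG : RayDecay (rays θ θ) G) (hF' : RayDecay (rays (-θ) (-θ)) F)
    (hG' : RayDecay (rays (-θ) (-θ)) G) :
    contourIntegral (fun z => F z - G z) θ = contourIntegral F θ - contourIntegral G θ := by
  rw [contourIntegral, rayIntegral_sub hF hG, rayIntegral_sub hF' hG', contourIntegral,
    contourIntegral]
  abel

theorem contourIntegral_const_mul (c : ℂ) (F : ℂ → ℂ) (θ : ℝ) :
    contourIntegral (fun z => c * F z) θ = c * contourIntegral F θ := by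
  simp only [contourIntegral, rayIntegral, smul_eq_mul, mul_left_comm _ c, mul_sub,
    integral_const_mul]

theorem contourIntegral_smul_const [CompleteSpace E] (f : ℂ → ℂ) (x : E) (θ : ℝ) :
    contourIntegral (fun z => f z • x) θ = contourIntegral f θ • x := by
  simp only [contourIntegral, rayIntegral, sub_smul, smul_eq_mul, ← smul_assoc,
    integral_smul_const]

end Linear

/-! ### A kernel with two opposite poles -/

/-- The rational function `2z / (w² - z²)` of `w`, with the poles `z` and `-z`. -/
def pairKernel (z w : ℂ) : ℂ := 2 * z * ((z - w)⁻¹ * (-z - w)⁻¹)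

theorem rayDecay_pairKernel {S : Set ℂ} {z : ℂ} (hz : z ≠ 0) (h : z ∉ S) (h' : -z ∉ S) :
    RayDecay S (pairKernel z) := by
  have := ((sectorDecay_inv_sub hz h).const_mul (2 * z)).rayDecay_mul
    (sectorDecay_inv_sub (neg_ne_zero.2 hz) h')
  simp only [mul_assoc (2 * z)] at this
  exact this

theorem integral_Ioi_div_sq_add_sq {ρ : ℝ} (hρ : 0 < ρ) :
    ∫ r in Ioi (0 : ℝ), 2 * ρ / (r ^ 2 + ρ ^ 2) = Real.pi := by
  have h := integral_comp_mul_left_Ioi (fun x : ℝ => (1 + x ^ 2)⁻¹) 0 (inv_pos.2 hρ)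
  rw [mul_zero, integral_Ioi_inv_one_add_sq, Real.arctan_zero, inv_inv, smul_eq_mul] at h
  have h2 : ∀ r : ℝ, 2 * ρ / (r ^ 2 + ρ ^ 2) = 2 / ρ * (1 + (ρ⁻¹ * r) ^ 2)⁻¹ := by
    intro r
    have : r ^ 2 + ρ ^ 2 ≠ 0 := by positivity
    have : (1 + (ρ⁻¹ * r) ^ 2) ≠ 0 := by positivity
    field_simp
    ring
  simp_rw [h2]
  rw [integral_const_mul, h]
  field_simp
  ring

/-- On the ray orthogonal to z = ρe^{iψ} one has w = u r e^{iψ} with u² = -1, so w² - z² =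
-e^{2iψ}(r² + ρ²) and the integrand reduces to -u·2ρ/(r² + ρ²), an arctangent integral. -/
theorem rayIntegral_pairKernel_aux {ψ ρ χ : ℝ} (hρ : 0 < ρ) {u : ℂ} (hu : u ^ 2 = -1)
    (hχ : Complex.exp (χ * Complex.I) = u * Complex.exp (ψ * Complex.I)) :
    rayIntegral (pairKernel (rayPoint ψ ρ)) χ = -u * Real.pi := by
  have h : ∀ r ∈ Ioi (0 : ℝ), Complex.exp (χ * Complex.I) • pairKernel (rayPoint ψ ρ)
      (rayPoint χ r) = -u * ((2 * ρ / (r ^ 2 + ρ ^ 2) : ℝ) : ℂ) := by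
    intro r _
    have he := Complex.exp_ne_zero (ψ * Complex.I)
    have h0 : (r : ℂ) ^ 2 + (ρ : ℂ) ^ 2 ≠ 0 := by
      have : r ^ 2 + ρ ^ 2 ≠ 0 := by positivity
      exact_mod_cast this
    rw [pairKernel, ← mul_inv, rayPoint, rayPoint, hχ, smul_eq_mul]
    set e := Complex.exp (ψ * Complex.I)
    have h1 : (ρ * e - r * (u * e)) * (-(ρ * e) - r * (u * e)) = -(e ^ 2 * (r ^ 2 + ρ ^ 2)) := by
      linear_combination (e ^ 2 * r ^ 2) * hu
    rw [h1]
    push_cast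
    field_simp
  rw [rayIntegral, setIntegral_congr_fun measurableSet_Ioi h, integral_const_mul,
    integral_complex_ofReal, integral_Ioi_div_sq_add_sq hρ]

theorem exp_add_pi_div_two_mul_I (ψ : ℝ) :
    Complex.exp ((ψ + Real.pi / 2 : ℝ) * Complex.I) =
      Complex.I * Complex.exp (ψ * Complex.I) := by
  push_cast
  rw [add_mul, Complex.exp_add, Complex.exp_pi_div_two_mul_I, mul_comm]

theorem exp_sub_pi_div_two_mul_I (ψ : ℝ) :
    Complex.exp ((ψ - Real.pi / 2 : ℝ) * Complex.I) =
      -Complex.I * Complex.exp (ψ * Complex.I) := by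
  push_cast
  rw [sub_mul, sub_eq_add_neg, Complex.exp_add, Complex.exp_neg, Complex.exp_pi_div_two_mul_I,
    Complex.inv_I, mul_comm]

theorem notMem_rays_of_sin_ne_zero {ψ ρ c a b : ℝ} (h : ∀ χ ∈ Icc a b, Real.sin (χ - ψ) ≠ 0) :
    (c : ℂ) * rayPoint ψ ρ ∉ rays a b := by
  rintro ⟨χ, hχ, r, hr, he⟩
  exact rayPoint_ne_real_mul (h χ hχ) hr he

theorem rayDecay_pairKernel_rays {ψ ρ a b : ℝ} (hρ : 0 < ρ)
    (h : ∀ χ ∈ Icc a b, Real.sin (χ - ψ) ≠ 0) :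
    RayDecay (rays a b) (pairKernel (rayPoint ψ ρ)) :=
  rayDecay_pairKernel (rayPoint_ne_zero hρ)
    (by simpa using notMem_rays_of_sin_ne_zero (ρ := ρ) (c := 1) h)
    (by simpa using notMem_rays_of_sin_ne_zero (ρ := ρ) (c := -1) h)

theorem rayIntegral_pairKernel_eq {ψ ρ χ χ' : ℝ} (hρ : 0 < ρ)
    (h : ∀ x ∈ uIcc χ χ', Real.sin (x - ψ) ≠ 0) :
    rayIntegral (pairKernel (rayPoint ψ ρ)) χ = rayIntegral (pairKernel (rayPoint ψ ρ)) χ' := by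
  rcases le_total χ χ' with hl | hl
  · rw [uIcc_of_le hl] at h
    exact (rayDecay_pairKernel_rays hρ h).rayIntegral_eq hl
  · rw [uIcc_of_ge hl] at h
    exact ((rayDecay_pairKernel_rays hρ h).rayIntegral_eq hl).symm

/-- The rays of angles ±θ are turned to the angles ψ ± π/2, where the integral is explicit. The
bounds on θ keep both rays away from the poles z and -z during the rotation. Unlike 1/(w - z), this
kernel is O(1/|w|²), so no residue theorem or limiting contour is needed. -/
theorem contourIntegral_pairKernel {ψ ρ θ : ℝ} (hρ : 0 < ρ) (h : |ψ| < θ)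
    (h' : θ < Real.pi - |ψ|) :
    contourIntegral (pairKernel (rayPoint ψ ρ)) θ = 2 * Real.pi * Complex.I := by
  have hψ := abs_lt.1 h
  have hψ1 := neg_abs_le ψ
  have hψ2 := le_abs_self ψ
  have hpi := Real.pi_pos
  have h1 : rayIntegral (pairKernel (rayPoint ψ ρ)) θ = -Complex.I * Real.pi := by
    rw [← rayIntegral_pairKernel_aux hρ Complex.I_sq (exp_add_pi_div_two_mul_I ψ)]
    refine rayIntegral_pairKernel_eq hρ fun x hx => ne_of_gt (Real.sin_pos_of_pos_of_lt_pi ?_ ?_)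
    · rcases mem_uIcc.1 hx with hx | hx <;> linarith [hx.1]
    · rcases mem_uIcc.1 hx with hx | hx <;> linarith [hx.2]
  have h2 : rayIntegral (pairKernel (rayPoint ψ ρ)) (-θ) = Complex.I * Real.pi := by
    rw [show Complex.I * Real.pi = -(-Complex.I) * Real.pi by ring,
      ← rayIntegral_pairKernel_aux hρ (by simp) (exp_sub_pi_div_two_mul_I ψ)]
    refine rayIntegral_pairKernel_eq hρ fun x hx =>
      ne_of_lt (Real.sin_neg_of_neg_of_neg_pi_lt ?_ ?_)
    · rcases mem_uIcc.1 hx with hx | hx <;> linarith [hx.2]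
    · rcases mem_uIcc.1 hx with hx | hx <;> linarith [hx.1]
  rw [contourIntegral, h1, h2]
  ring

theorem notMem_rays_of_abs_lt {ψ ρ θ : ℝ} (hρ : 0 < ρ) (hψ : |ψ| ≤ Real.pi) (h : θ < |ψ|) :
    rayPoint ψ ρ ∉ rays (-θ) θ := by
  rintro ⟨χ, hχ, r, hr, he⟩
  have h1 := congrArg (fun z => |Complex.arg z|) he
  have h2 : |χ| ≤ θ := abs_le.2 hχ
  simp only [abs_arg_rayPoint hψ hρ, abs_arg_rayPoint (by linarith : |χ| ≤ Real.pi) hr] at h1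
  linarith

theorem neg_rayPoint_notMem_rays {ψ ρ θ : ℝ} (hρ : 0 < ρ) (h' : θ < Real.pi - |ψ|) :
    -rayPoint ψ ρ ∉ rays (-θ) θ := by
  rintro ⟨χ, hχ, r, hr, he⟩
  have h2 : |χ - ψ| < Real.pi := by
    have := abs_sub χ ψ
    have : |χ| ≤ θ := abs_le.2 hχ
    linarith
  have h3 : Real.sin (χ - ψ) = 0 := by
    by_contra h
    exact rayPoint_ne_real_mul (c := -1) h hr (by simpa using he)
  have h4 := (Real.sin_eq_zero_iff_of_lt_of_lt (abs_lt.1 h2).1 (abs_lt.1 h2).2).1 h3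
  obtain rfl : χ = ψ := by linarith
  have h5 : rayPoint χ (r + ρ) = 0 := by
    rw [rayPoint, rayPoint] at he
    rw [rayPoint]
    push_cast
    linear_combination he
  exact rayPoint_ne_zero (add_pos hr hρ) h5

/-- The estimates concern only 0 and infinity, so they may be read off a formula that fails at a
single point z ≠ 0. This is how removable singularities are handled. -/
theorem RayDecay.of_eqOn_sdiff_singleton {E : Type*} [NormedAddCommGroup E] [NormedSpace ℂ E]
    {S : Set ℂ} {z : ℂ} {F G : ℂ → E}
    (hG : RayDecay (S \ {z}) G) (hz : z ≠ 0) (heq : ∀ w ∈ S, w ≠ z → F w = G w)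
    (hd : ∀ w ∈ S, DifferentiableAt ℂ F w) : RayDecay S F where
  diff := hd
  zero := by
    obtain ⟨p, hp, h⟩ := hG.zero
    have hne : {z}ᶜ ∈ 𝓝[S] (0 : ℂ) := nhdsWithin_le_nhds (isOpen_ne.mem_nhds hz.symm)
    have he : 𝓝[S \ {z}] (0 : ℂ) = 𝓝[S] 0 := by
      rw [sdiff_eq, inter_comm]
      exact nhdsWithin_inter_of_mem hne
    rw [he] at h
    refine ⟨p, hp, h.congr' ?_ EventuallyEq.rfl⟩
    filter_upwards [self_mem_nhdsWithin, hne] with w hw hwz using (heq w hw hwz).symm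
  infty := by
    obtain ⟨q, hq, h⟩ := hG.infty
    have hne : ∀ᶠ w in Bornology.cobounded ℂ ⊓ 𝓟 S, w ≠ z := by
      have := (tendsto_norm_cobounded_atTop (E := ℂ)).eventually (eventually_gt_atTop ‖z‖)
      filter_upwards [this.filter_mono inf_le_left] with w hw hwz
      exact hw.ne' (by rw [hwz])
    have hS : ∀ᶠ w in Bornology.cobounded ℂ ⊓ 𝓟 S, w ∈ S :=
      mem_inf_of_right (mem_principal_self S)
    have hle : Bornology.cobounded ℂ ⊓ 𝓟 S ≤ Bornology.cobounded ℂ ⊓ 𝓟 (S \ {z}) := by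
      refine le_inf inf_le_left (le_principal_iff.2 ?_)
      filter_upwards [hne, hS] with w hw hwS using ⟨hwS, hw⟩
    refine ⟨q, hq, (h.mono hle).congr' ?_ EventuallyEq.rfl⟩
    filter_upwards [hne, hS] with w hw hwS using (heq w hwS hw).symm

theorem RayDecay.add {E : Type*} [NormedAddCommGroup E] [NormedSpace ℂ E] {S : Set ℂ}
    {F G : ℂ → E} (hF : RayDecay S F) (hG : RayDecay S G) (h0 : (0 : ℂ) ∉ S) :
    RayDecay S fun z => F z + G z where
  diff z hz := (hF.diff z hz).add (hG.diff z hz)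
  zero := by
    obtain ⟨p, hp, h⟩ := hF.zero
    obtain ⟨p', hp', h'⟩ := hG.zero
    refine ⟨max p p', max_lt hp hp', ?_⟩
    have hO : ∀ s, s ≤ max p p' → (fun z : ℂ => ‖z‖ ^ (-s)) =O[𝓝[S] 0]
        fun z => ‖z‖ ^ (-max p p') := fun s hs => isBigO_norm_rpow_zero (neg_le_neg hs) h0
    exact (h.trans (hO p (le_max_left _ _))).add (h'.trans (hO p' (le_max_right _ _)))
  infty := by
    obtain ⟨q, hq, h⟩ := hF.infty
    obtain ⟨q', hq', h'⟩ := hG.infty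
    exact ⟨min q q', lt_min hq hq',
      (h.trans (isBigO_norm_rpow_cobounded (neg_le_neg (min_le_left _ _)) S)).add
        (h'.trans (isBigO_norm_rpow_cobounded (neg_le_neg (min_le_right _ _)) S))⟩

theorem RayDecay.smul_const {E : Type*} [NormedAddCommGroup E] [NormedSpace ℂ E] {S : Set ℂ}
    {f : ℂ → ℂ} (hf : RayDecay S f) (x : E) : RayDecay S fun z => f z • x where
  diff z hz := (hf.diff z hz).smul_const x
  zero := hf.zero.imp fun p h => ⟨h.1, by
    simpa using h.2.smul (Asymptotics.isBigO_const_const x (one_ne_zero (α := ℝ)) _)⟩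
  infty := hf.infty.imp fun p h => ⟨h.1, by
    simpa using h.2.smul (Asymptotics.isBigO_const_const x (one_ne_zero (α := ℝ)) _)⟩

theorem contourIntegral_add {E : Type*} [NormedAddCommGroup E] [NormedSpace ℂ E] {F G : ℂ → E}
    {θ : ℝ} (hF : RayDecay (rays θ θ) F)
    (hG : RayDecay (rays θ θ) G) (hF' : RayDecay (rays (-θ) (-θ)) F)
    (hG' : RayDecay (rays (-θ) (-θ)) G) :
    contourIntegral (fun z => F z + G z) θ = contourIntegral F θ + contourIntegral G θ := by
  have h := contourIntegral_sub (hF.add hG zero_notMem_rays) hG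
    (hF'.add hG' zero_notMem_rays) hG'
  simp only [add_sub_cancel_right] at h
  rw [h, sub_add_cancel]

/-- **Cauchy's integral formula** for the path `Γ_θ`. -/
theorem SectorDecay.contourIntegral_cauchy {f : ℂ → ℂ} {θ ψ ρ : ℝ}
    (hf : SectorDecay (rays (-θ) θ) f) (hρ : 0 < ρ) (hψ : |ψ| < θ) (hψ' : θ < Real.pi - |ψ|) :
    contourIntegral (fun w => f w * (rayPoint ψ ρ - w)⁻¹) θ =
      -(2 * Real.pi * Complex.I * f (rayPoint ψ ρ)) := by
  set z := rayPoint ψ ρ with hz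
  have hθ : 0 ≤ θ := (abs_nonneg ψ).trans hψ.le
  have hθ' : θ ≤ Real.pi := by linarith [abs_nonneg ψ]
  have hz0 : z ≠ 0 := rayPoint_ne_zero hρ
  have hnz : -z ∉ rays (-θ) θ := neg_rayPoint_notMem_rays hρ hψ'
  have hz1 : ∀ σ : ℝ, σ = 1 ∨ σ = -1 → z ∉ rays (σ * θ) (σ * θ) := by
    rintro σ hσ ⟨χ, hχ, r, hr, he⟩
    obtain rfl := le_antisymm hχ.2 hχ.1
    have h0 : |σ * θ| = θ := by rcases hσ with rfl | rfl <;> simp [abs_of_nonneg hθ]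
    have h1 := congrArg (fun z => |Complex.arg z|) he
    simp only [hz, abs_arg_rayPoint (hψ.le.trans hθ') hρ,
      abs_arg_rayPoint (by rw [h0]; exact hθ') hr, h0] at h1
    exact hψ.ne' h1
  have hza : z ∉ rays θ θ := by simpa using hz1 1 (Or.inl rfl)
  have hzb : z ∉ rays (-θ) (-θ) := by simpa using hz1 (-1) (Or.inr rfl)
  have hsa : rays θ θ ⊆ rays (-θ) θ := rays_mono (by linarith) le_rfl
  have hsb : rays (-θ) (-θ) ⊆ rays (-θ) θ := rays_mono le_rfl (by linarith)
  -- Subtracting the pole of f(w)/(z - w) by means of `pairKernel`, rather than a simple fraction,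
  -- preserves the decay at infinity. The sum has a removable singularity at z, and `dslope` is its
  -- extension there; the other pole -z lies outside the sector.
  set G : ℂ → ℂ := fun w => -dslope f z w + f z * (-z - w)⁻¹ with hG
  have hGeq : ∀ w, w ≠ z → w ≠ -z → G w = f w * (z - w)⁻¹ + f z * pairKernel z w := by
    intro w hw hw'
    have h1 : w - z ≠ 0 := sub_ne_zero.2 hw
    have h2 : z - w ≠ 0 := sub_ne_zero.2 hw.symm
    have h3 : -z - w ≠ 0 := sub_ne_zero.2 hw'.symm
    rw [hG]
    simp only [pairKernel, dslope_of_ne f hw, slope_def_field]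
    rw [show w - z = -(z - w) by ring]
    field_simp
    ring
  have hGdecay : RayDecay (rays (-θ) θ) G := by
    refine RayDecay.of_eqOn_sdiff_singleton (z := z)
      (((hf.mono sdiff_subset).rayDecay_mul
        (sectorDecay_inv_sub (S := rays (-θ) θ \ {z}) hz0 fun h => h.2 rfl)).add
        ((rayDecay_pairKernel (S := rays (-θ) θ \ {z}) hz0 (fun h => h.2 rfl)
          fun h => hnz h.1).const_mul (f z)) fun h => zero_notMem_rays h.1)
      hz0 (fun w hw hwz => hGeq w hwz fun h => hnz (h ▸ hw)) fun w hw => ?_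
    have h1 : DifferentiableAt ℂ (dslope f z) w := by
      by_cases hwz : w = z
      · have hd : DifferentiableOn ℂ f (rays (-θ) θ) :=
          fun x hx => (hf.diff x hx).differentiableWithinAt
        rw [hwz]
        exact ((Complex.differentiableOn_dslope (rays_mem_nhds hθ' hψ hρ)).2 hd).differentiableAt
          (rays_mem_nhds hθ' hψ hρ)
      · exact (differentiableAt_dslope_of_ne hwz).2 (hf.diff w hw)
    have h2 : -z - w ≠ 0 := sub_ne_zero.2 fun h => hnz (h ▸ hw)
    exact h1.neg.add
      ((((differentiableAt_const _).sub differentiableAt_id).inv h2).const_mul (f z))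
  have h0 := hGdecay.contourIntegral_eq_zero hθ
  have hK : ∀ S : Set ℂ, S ⊆ rays (-θ) θ → z ∉ S → RayDecay S fun w => f z * pairKernel z w :=
    fun S hS hzS => (rayDecay_pairKernel hz0 hzS fun h => hnz (hS h)).const_mul (f z)
  have hF : ∀ S : Set ℂ, S ⊆ rays (-θ) θ → z ∉ S → RayDecay S fun w => f w * (z - w)⁻¹ :=
    fun S hS hzS => (hf.mono hS).rayDecay_mul (sectorDecay_inv_sub hz0 hzS)
  rw [contourIntegral_congr
      (fun w hw => hGeq w (ne_of_mem_of_not_mem hw hza) fun h => hnz (h ▸ hsa hw))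
      (fun w hw => hGeq w (ne_of_mem_of_not_mem hw hzb) fun h => hnz (h ▸ hsb hw)),
    contourIntegral_add (hF _ hsa hza) (hK _ hsa hza) (hF _ hsb hzb) (hK _ hsb hzb),
    contourIntegral_const_mul, hz, contourIntegral_pairKernel hρ hψ hψ'] at h0
  linear_combination h0

end

section
variable {X : Type*} [NormedAddCommGroup X] [NormedSpace ℂ X]

/-! ### Resolvents -/

theorem resolvent_identity {A : X →ₗ.[ℂ] X} {z w : ℂ} (hz : z ∈ resolventSet A)
    (hw : w ∈ resolventSet A) :
    resolventOp A z - resolventOp A w = (w - z) • (resolventOp A z * resolventOp A w) := by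
  ext x
  obtain ⟨h, e⟩ := (isResolventAt_resolventOp hw).1 x
  have h1 := (isResolventAt_resolventOp hz).2 ⟨resolventOp A w x, h⟩
  have h2 : z • resolventOp A w x - A ⟨resolventOp A w x, h⟩ =
      x + (z - w) • resolventOp A w x := by
    rw [sub_smul]
    nth_rewrite 3 [← e]
    abel
  simp only [h2, map_add, map_smul] at h1
  change resolventOp A z x - resolventOp A w x =
    (w - z) • resolventOp A z (resolventOp A w x)
  rw [sub_eq_iff_eq_add', ← sub_eq_iff_eq_add, ← neg_sub z w, neg_smul, sub_neg_eq_add, h1]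

theorem resolventOp_mul_comm {A : X →ₗ.[ℂ] X} {z w : ℂ} (hz : z ∈ resolventSet A)
    (hw : w ∈ resolventSet A) :
    resolventOp A z * resolventOp A w = resolventOp A w * resolventOp A z := by
  rcases eq_or_ne z w with rfl | h
  · rfl
  · refine smul_right_injective _ (sub_ne_zero.2 h.symm) ?_
    simp only
    rw [← resolvent_identity hz hw, ← neg_sub z w, neg_smul, ← resolvent_identity hw hz, neg_sub]

theorem inv_smul_resolvent_sub {A : X →ₗ.[ℂ] X} {z w : ℂ} (hz : z ∈ resolventSet A)
    (hw : w ∈ resolventSet A) (h : w ≠ z) :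
    resolventOp A w * resolventOp A z =
      (w - z)⁻¹ • resolventOp A z - (w - z)⁻¹ • resolventOp A w := by
  rw [resolventOp_mul_comm hw hz, ← smul_sub, resolvent_identity hz hw,
    inv_smul_smul₀ (sub_ne_zero.2 h)]

theorem notMem_closedSector_iff {μ : ℝ} {z : ℂ} :
    z ∉ closedSector μ ↔ z ≠ 0 ∧ μ < |z.arg| := by
  simp only [closedSector, mem_union, mem_ofPred_eq, mem_singleton_iff, not_or, not_and, not_le]
  exact ⟨fun h => ⟨h.2, h.1 h.2⟩, fun h => ⟨fun _ => h.2, h.1⟩⟩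

/-- Since `arg` jumps across the negative axis, the complement is described instead by the
continuous condition Re z < |z| cos μ. -/
theorem isOpen_compl_closedSector {μ : ℝ} (h0 : 0 ≤ μ) (hμ : μ ≤ Real.pi) :
    IsOpen (closedSector μ)ᶜ := by
  have : (closedSector μ)ᶜ = {z : ℂ | z.re < ‖z‖ * Real.cos μ} := by
    ext z
    rw [mem_compl_iff, notMem_closedSector_iff, mem_ofPred_eq]
    rcases eq_or_ne z 0 with rfl | hz
    · simp
    · have h1 : z.re = ‖z‖ * Real.cos |z.arg| := by
        rw [Real.cos_abs, Complex.norm_mul_cos_arg]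
      rw [h1, mul_lt_mul_iff_right₀ (norm_pos_iff.2 hz), Real.strictAntiOn_cos.lt_iff_gt
        ⟨abs_nonneg _, Complex.abs_arg_le_pi z⟩ ⟨h0, hμ⟩]
      simp [hz]
  rw [this]
  exact isOpen_lt Complex.continuous_re (continuous_norm.mul continuous_const)

section

variable {A : X →ₗ.[ℂ] X} {ω γ : ℝ}

theorem IsAlmostSectorial.mem_resolventSet (hA : IsAlmostSectorial A ω γ) {μ : ℝ} (hμ : ω ≤ μ)
    {z : ℂ} (hz : z ∉ closedSector μ) : z ∈ resolventSet A := by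
  by_contra h
  rw [notMem_closedSector_iff] at hz
  exact notMem_closedSector_iff.2 ⟨hz.1, hμ.trans_lt hz.2⟩ (hA.spectrum_subset h)

/-- The assumed resolvent bound gives local boundedness; the resolvent identity upgrades this to
continuity and then to the derivative -R(z)². No Neumann series, hence no completeness of X, enters.
-/
theorem IsAlmostSectorial.differentiableAt (hA : IsAlmostSectorial A ω γ) (hω : 0 ≤ ω) {μ : ℝ}
    (hμ : ω < μ) (hμ' : μ < Real.pi) {z : ℂ} (hz : z ∉ closedSector μ) :
    DifferentiableAt ℂ (resolventOp A) z := by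
  obtain ⟨C, hC, hb⟩ := hA.resolvent_bound μ hμ hμ'
  have hU : (closedSector μ)ᶜ ∈ 𝓝 z :=
    (isOpen_compl_closedSector (hω.trans hμ.le) hμ'.le).mem_nhds hz
  have hz0 : z ≠ 0 := (notMem_closedSector_iff.1 hz).1
  have hzρ := hA.mem_resolventSet hμ.le hz
  have hbdd : (resolventOp A) =O[𝓝 z] fun _ => (1 : ℝ) := by
    have h1 : (fun w : ℂ => C * ‖w‖ ^ γ) =O[𝓝 z] fun _ => (1 : ℝ) := by
      have : ContinuousAt (fun w : ℂ => C * ‖w‖ ^ γ) z :=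
        continuousAt_const.mul (continuous_norm.continuousAt.rpow_const
          (Or.inl (norm_ne_zero_iff.2 hz0)))
      exact this.tendsto.isBigO_one ℝ
    refine Asymptotics.IsBigO.trans (Asymptotics.IsBigO.of_bound 1 ?_) h1
    filter_upwards [hU] with w hw
    rw [one_mul]
    exact (hb w hw).trans (le_abs_self _)
  have hcont : Tendsto (resolventOp A) (𝓝 z) (𝓝 (resolventOp A z)) := by
    rw [← tendsto_sub_nhds_zero_iff]
    have h1 : (fun w => resolventOp A w - resolventOp A z) =ᶠ[𝓝 z]
        fun w => (z - w) • (resolventOp A w * resolventOp A z) := by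
      filter_upwards [hU] with w hw using resolvent_identity (hA.mem_resolventSet hμ.le hw) hzρ
    rw [tendsto_congr' h1]
    have h2 : Tendsto (fun w => z - w) (𝓝 z) (𝓝 0) := by
      simpa using (tendsto_const_nhds (x := z)).sub (tendsto_id (x := 𝓝 z))
    have h3 : (fun w => resolventOp A w * resolventOp A z) =O[𝓝 z] fun _ => (1 : ℝ) := by
      simpa using hbdd.mul (Asymptotics.isBigO_const_const (resolventOp A z)
        (one_ne_zero (α := ℝ)) (𝓝 z))
    refine Asymptotics.IsBigO.trans_tendsto (g'' := fun w => ‖z - w‖) ?_ (by simpa using h2.norm)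
    simpa using ((Asymptotics.isBigO_refl (fun w => z - w) (𝓝 z)).norm_right).smul h3
  have hd : HasDerivAt (resolventOp A) (-(resolventOp A z * resolventOp A z)) z := by
    rw [hasDerivAt_iff_tendsto_slope]
    have h1 : slope (resolventOp A) z =ᶠ[𝓝[≠] z]
        fun w => -(resolventOp A w * resolventOp A z) := by
      filter_upwards [nhdsWithin_le_nhds hU, self_mem_nhdsWithin] with w hw hwz
      rw [slope_def_module, resolvent_identity (hA.mem_resolventSet hμ.le hw) hzρ, ← neg_sub w z,
        neg_smul, smul_neg, inv_smul_smul₀ (sub_ne_zero.2 hwz)]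
    rw [tendsto_congr' h1]
    exact ((hcont.mul_const _).neg).mono_left nhdsWithin_le_nhds
  exact hd.differentiableAt

theorem IsAlmostSectorial.exists_isBigO (hA : IsAlmostSectorial A ω γ) {μ : ℝ}
    (hμ : ω < μ) (hμ' : μ < Real.pi) {S : Set ℂ} (hS : S ⊆ (closedSector μ)ᶜ) {l : Filter ℂ}
    (hl : S ∈ l) : (resolventOp A) =O[l] fun z => ‖z‖ ^ γ := by
  obtain ⟨C, hC, hb⟩ := hA.resolvent_bound μ hμ hμ'
  refine Asymptotics.IsBigO.of_bound C ?_
  filter_upwards [hl] with z hz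
  rw [Real.norm_of_nonneg (by positivity)]
  exact hb z (hS hz)

/-- The two bounds on γ act here: γ > -1 gives integrability at 0, where f is merely bounded, and γ
< 0 gives it at infinity, where f is merely O(1/|z|). -/
theorem SectorDecay.rayDecay_smul (hA : IsAlmostSectorial A ω γ) (hω : 0 ≤ ω) (hγ : -1 < γ)
    (hγ' : γ < 0) {μ : ℝ} (hμ : ω < μ) (hμ' : μ < Real.pi) {S : Set ℂ}
    (hS : S ⊆ (closedSector μ)ᶜ) {f : ℂ → ℂ} (hf : SectorDecay S f) :
    RayDecay S fun z => f z • resolventOp A z where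
  diff z hz := (hf.diff z hz).smul (hA.differentiableAt hω hμ hμ' (hS hz))
  zero := ⟨-γ, by linarith, by
    simpa using hf.zero.smul (hA.exists_isBigO hμ hμ' hS self_mem_nhdsWithin)⟩
  infty := ⟨1 - γ, by linarith, by
    have := isBigO_mul_cobounded hf.infty
      (hA.exists_isBigO hμ hμ' hS (mem_inf_of_right (mem_principal_self S)))
    rwa [show -1 + γ = -(1 - γ) by ring] at this⟩

theorem rays_subset_compl_closedSector {μ a b : ℝ} (h0 : 0 ≤ μ) (ha : μ < a) (hb : b ≤ Real.pi) :
    rays a b ⊆ (closedSector μ)ᶜ := by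
  rintro z ⟨θ, hθ, r, hr, rfl⟩
  have h1 : |θ| = θ := abs_of_nonneg (h0.trans (ha.le.trans hθ.1))
  refine notMem_closedSector_iff.2 ⟨rayPoint_ne_zero hr, ?_⟩
  rw [abs_arg_rayPoint (h1.le.trans (hθ.2.trans hb)) hr, h1]
  exact ha.trans_le hθ.1

theorem rays_neg_subset_compl_closedSector {μ a b : ℝ} (h0 : 0 ≤ μ) (ha : μ < a)
    (hb : b ≤ Real.pi) : rays (-b) (-a) ⊆ (closedSector μ)ᶜ := by
  rintro z ⟨θ, hθ, r, hr, rfl⟩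
  have h1 : |θ| = -θ := abs_of_nonpos (by linarith [hθ.2])
  refine notMem_closedSector_iff.2 ⟨rayPoint_ne_zero hr, ?_⟩
  rw [abs_arg_rayPoint (by linarith [hθ.1]) hr, h1]
  linarith [hθ.2]

end

section CLM

variable {E E' : Type*} [NormedAddCommGroup E] [NormedSpace ℂ E] [CompleteSpace E]
  [NormedAddCommGroup E'] [NormedSpace ℂ E'] [CompleteSpace E']

theorem rayIntegral_clm (L : E →L[ℂ] E') {F : ℂ → E} {θ : ℝ} (hF : RayDecay (rays θ θ) F) :
    rayIntegral (fun z => L (F z)) θ = L (rayIntegral F θ) := by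
  rw [rayIntegral, rayIntegral,
    ← L.integral_comp_comm (hF.integrableOn_smul ⟨le_rfl, le_rfl⟩)]
  simp only [map_smul]

theorem contourIntegral_clm (L : E →L[ℂ] E') {F : ℂ → E} {θ : ℝ} (hF : RayDecay (rays θ θ) F)
    (hF' : RayDecay (rays (-θ) (-θ)) F) :
    contourIntegral (fun z => L (F z)) θ = L (contourIntegral F θ) := by
  rw [contourIntegral, rayIntegral_clm L hF, rayIntegral_clm L hF', contourIntegral, map_sub]

end CLM

end

section
variable {X : Type*} [NormedAddCommGroup X] [NormedSpace ℂ X]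

/-! ### The operators `f(A)` -/

theorem rayIntegrand_eq (A : X →ₗ.[ℂ] X) (f : ℂ → ℂ) (θ r : ℝ) : rayIntegrand A f θ r =
    Complex.exp (θ * Complex.I) • (f (rayPoint θ r) • resolventOp A (rayPoint θ r)) := by
  rw [rayIntegrand, smul_smul, mul_comm]

theorem contourOp_eq (A : X →ₗ.[ℂ] X) (f : ℂ → ℂ) (θ : ℝ) : contourOp A f θ =
    (2 * Real.pi * Complex.I : ℂ)⁻¹ • contourIntegral (fun z => f z • resolventOp A z) θ := by
  simp only [contourOp, contourIntegral, rayIntegral, rayIntegrand_eq]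

variable {A : X →ₗ.[ℂ] X} {ω γ : ℝ}

theorem SectorDecay.rayDecay_rays (hA : IsAlmostSectorial A ω γ) (hω : 0 ≤ ω) (hγ : -1 < γ)
    (hγ' : γ < 0) {f : ℂ → ℂ} {μ θ θ' : ℝ} (hf : SectorDecay (rays (-μ) μ) f) (hμ : μ ≤ Real.pi)
    (hωθ : ω < θ) (hθ : θ ≤ θ') (hθ' : θ' ≤ μ) :
    RayDecay (rays θ θ') (fun z => f z • resolventOp A z) ∧
      RayDecay (rays (-θ') (-θ)) (fun z => f z • resolventOp A z) := by
  obtain ⟨ν, hν, hν'⟩ := exists_between hωθ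
  have hνπ : ν < Real.pi := by linarith
  exact ⟨(hf.mono (rays_mono (by linarith) hθ')).rayDecay_smul hA hω hγ hγ' hν hνπ
      (rays_subset_compl_closedSector (by linarith) hν' (hθ'.trans hμ)),
    (hf.mono (rays_mono (by linarith) (by linarith))).rayDecay_smul hA hω hγ hγ' hν hνπ
      (rays_neg_subset_compl_closedSector (by linarith) hν' (hθ'.trans hμ))⟩

theorem SectorDecay.contourIntegrable (hA : IsAlmostSectorial A ω γ) (hω : 0 ≤ ω) (hγ : -1 < γ)
    (hγ' : γ < 0) {f : ℂ → ℂ} {θ : ℝ} (hf : SectorDecay (rays (-θ) θ) f) (hθ : θ ≤ Real.pi)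
    (hωθ : ω < θ) : ContourIntegrable A f θ := by
  have h := hf.rayDecay_rays hA hω hγ hγ' hθ hωθ le_rfl le_rfl
  constructor
  · rw [funext (rayIntegrand_eq A f θ)]
    exact h.1.integrableOn_smul ⟨le_rfl, le_rfl⟩
  · rw [funext (rayIntegrand_eq A f (-θ))]
    exact h.2.integrableOn_smul ⟨le_rfl, le_rfl⟩

theorem SectorDecay.contourOp_eq_contourOp (hA : IsAlmostSectorial A ω γ) (hω : 0 ≤ ω)
    (hγ : -1 < γ) (hγ' : γ < 0) {f : ℂ → ℂ} {μ θ θ' : ℝ} (hf : SectorDecay (rays (-μ) μ) f)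
    (hμ : μ ≤ Real.pi) (h1 : ω < θ) (h2 : θ ≤ μ) (h1' : ω < θ') (h2' : θ' ≤ μ) :
    contourOp A f θ = contourOp A f θ' := by
  wlog h : θ ≤ θ' generalizing θ θ'
  · exact (this h1' h2' h1 h2 (le_of_not_ge h)).symm
  · have hd := hf.rayDecay_rays hA hω hγ hγ' hμ h1 h h2'
    rw [contourOp_eq, contourOp_eq, hd.1.contourIntegral_eq hd.2 h]

theorem rayPoint_pi_one : rayPoint Real.pi 1 = -1 := by simp [rayPoint]

theorem rayPoint_zero_one : rayPoint 0 1 = 1 := by simp [rayPoint]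

variable [CompleteSpace X]

/-- The resolvent at a point outside of the sector multiplies the functional calculus. -/
theorem resolventOp_mul_contourOp (hA : IsAlmostSectorial A ω γ) (hω : 0 ≤ ω) (hγ : -1 < γ)
    (hγ' : γ < 0) {f : ℂ → ℂ} {θ : ℝ} (hf : SectorDecay (rays (-θ) θ) f) (hθ : θ ≤ Real.pi)
    (hωθ : ω < θ) {w : ℂ} (hw : w ∈ resolventSet A) (hw0 : w ≠ 0) (hwθ : w ∉ rays (-θ) θ) :
    resolventOp A w * contourOp A f θ = contourOp A (fun z => f z * (w - z)⁻¹) θ := by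
  have hd := hf.rayDecay_rays hA hω hγ hγ' hθ hωθ le_rfl le_rfl
  have hi := sectorDecay_inv_sub hw0 hwθ
  have hd' := (hf.mul hi).rayDecay_rays hA hω hγ hγ' hθ hωθ le_rfl le_rfl
  have hs := hf.rayDecay_mul hi
  have hsub : rays θ θ ⊆ rays (-θ) θ := rays_mono (by linarith) le_rfl
  have hsub' : rays (-θ) (-θ) ⊆ rays (-θ) θ := rays_mono le_rfl (by linarith)
  have hc : ∀ S : Set ℂ, S ⊆ rays (-θ) θ →
      RayDecay S fun z => (f z * (w - z)⁻¹) • resolventOp A w := fun S hS =>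
    (hs.mono hS).smul_const _
  have hR : ∀ z, z ∉ closedSector ω → z ∈ rays (-θ) θ →
      resolventOp A w * (f z • resolventOp A z) =
      (f z * (w - z)⁻¹) • resolventOp A z - (f z * (w - z)⁻¹) • resolventOp A w := by
    intro z hz hz'
    rw [mul_smul_comm, inv_smul_resolvent_sub (hA.mem_resolventSet le_rfl hz) hw
      (ne_of_mem_of_not_mem hz' hwθ).symm, smul_sub, smul_smul, smul_smul]
  rw [contourOp_eq, contourOp_eq, mul_smul_comm]
  congr 1
  change ContinuousLinearMap.mul ℂ (X →L[ℂ] X) (resolventOp A w) _ = _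
  rw [← contourIntegral_clm _ hd.1 hd.2]
  simp only [ContinuousLinearMap.mul_apply']
  -- By the resolvent identity the product splits into the desired integral and a scalar integral
  -- times R(w). The scalar function f(z)/(w - z) has no pole in the sector and is O(1/|z|²), so its
  -- integral vanishes.
  rw [contourIntegral_congr
      (fun z hz => hR z (rays_subset_compl_closedSector hω hωθ hθ hz) (hsub hz))
      (fun z hz => hR z (rays_neg_subset_compl_closedSector hω hωθ hθ hz) (hsub' hz)),
    contourIntegral_sub hd'.1 (hc _ hsub) hd'.2 (hc _ hsub'), contourIntegral_smul_const,
    hs.contourIntegral_eq_zero (by linarith), zero_smul, sub_zero]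

/-- The functional calculus reproduces the resolvent at `-1`. -/
theorem contourOp_inv_sub (hA : IsAlmostSectorial A ω γ) (hω : 0 ≤ ω) (hγ : -1 < γ)
    (hγ' : γ < 0) {θ : ℝ} (hθ : θ < Real.pi) (hωθ : ω < θ) :
    contourOp A (fun z => (-1 - z)⁻¹) θ = resolventOp A (-1) := by
  obtain ⟨ν, hν, hν'⟩ := exists_between hωθ
  have hν0 : 0 ≤ ν := by linarith
  have hνπ : ν < Real.pi := by linarith
  have hm1 : (-1 : ℂ) ∈ resolventSet A := by
    refine hA.mem_resolventSet hν.le (rays_subset_compl_closedSector hν0 hνπ le_rfl ?_)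
    rw [← rayPoint_pi_one]
    exact rayPoint_mem_rays ⟨le_rfl, le_rfl⟩ one_pos
  have hR1 : (1 : ℂ) ∈ closedSector ν := by simp [closedSector, hν0]
  -- The term R(z)R(-1) equals (R(z) - R(-1))/(-1 - z) off z = -1, so F has no pole at -1. The added
  -- (1 - z)⁻¹R(-1) cancels the O(1/|z|) tail, and its pole 1 lies inside the excluded sector.
  set F : ℂ → X →L[ℂ] X := fun z =>
    resolventOp A z * resolventOp A (-1) + (1 - z)⁻¹ • resolventOp A (-1) with hF
  have hFeq : ∀ z ∈ (closedSector ν)ᶜ, z ≠ -1 →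
      F z = (-1 - z)⁻¹ • resolventOp A z + (-(pairKernel 1 z)) • resolventOp A (-1) := by
    intro z hz hz1
    have h1 : (1 : ℂ) - z ≠ 0 := sub_ne_zero.2 (ne_of_mem_of_not_mem hR1 hz)
    have h2 : (-1 : ℂ) - z ≠ 0 := sub_ne_zero.2 hz1.symm
    have h3 : (1 - z)⁻¹ - (-1 - z)⁻¹ = -(pairKernel 1 z) := by
      rw [pairKernel]
      field_simp
      ring
    have hz' := hA.mem_resolventSet hν.le hz
    rw [hF]
    simp only
    rw [resolventOp_mul_comm hz' hm1, inv_smul_resolvent_sub hz' hm1 hz1.symm, ← h3, sub_smul]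
    abel
  have hdecay : ∀ S : Set ℂ, S ⊆ (closedSector ν)ᶜ → RayDecay S F := by
    intro S hS
    have h0 : (0 : ℂ) ∉ S := fun h => hS h (Or.inr rfl)
    have h1 : ∀ z ∈ S, z ≠ 1 := fun z hz => (ne_of_mem_of_not_mem hR1 (hS hz)).symm
    refine RayDecay.of_eqOn_sdiff_singleton (z := -1)
      (((sectorDecay_inv_sub (S := S \ {-1}) (by simp) fun h => h.2 rfl).rayDecay_smul hA hω hγ
        hγ' hν hνπ (sdiff_subset.trans hS)).add
        (((rayDecay_pairKernel (S := S \ {-1}) one_ne_zero (fun h => h1 _ h.1 rfl)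
          fun h => h.2 rfl).const_mul (-1)).smul_const (resolventOp A (-1))) fun h => h0 h.1)
      (by simp) (fun z hz hz1 => ?_) fun z hz => ?_
    · rw [hFeq z (hS hz) hz1, neg_one_mul]
    · exact ((hA.differentiableAt hω hν hνπ (hS hz)).mul_const _).add
        ((((differentiableAt_const _).sub differentiableAt_id).inv
          (sub_ne_zero.2 (h1 z hz).symm)).smul_const _)
  have hzero : contourIntegral F θ = 0 := by
    -- The path is opened up to the angle π, where its two rays coincide with the negative axis and
    -- cancel.
    rw [(hdecay _ (rays_subset_compl_closedSector hν0 hν' le_rfl)).contourIntegral_eq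
      (hdecay _ (rays_neg_subset_compl_closedSector hν0 hν' le_rfl)) hθ.le]
    have h1 : Complex.exp ((-Real.pi : ℝ) * Complex.I) = Complex.exp (Real.pi * Complex.I) := by
      simp [Complex.exp_neg]
    simp only [contourIntegral, rayIntegral, rayPoint, h1, sub_self]
  have hk := contourIntegral_pairKernel (ψ := 0) one_pos (θ := θ) (by simp; linarith)
    (by simpa using hθ)
  rw [rayPoint_zero_one] at hk
  have hK : ∀ S ⊆ (closedSector ν)ᶜ, (-1 : ℂ) ∉ S →
      RayDecay S fun z => pairKernel 1 z • resolventOp A (-1) := fun S hS hS1 =>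
    (rayDecay_pairKernel one_ne_zero (fun h => hS h hR1) hS1).smul_const _
  have hm : (-1 : ℂ) ∉ rays (-θ) θ := by
    rw [← rayPoint_pi_one]
    exact notMem_rays_of_abs_lt one_pos (by rw [abs_of_pos Real.pi_pos])
      (by rwa [abs_of_pos Real.pi_pos])
  have hma : (-1 : ℂ) ∉ rays θ θ := fun h => hm (rays_mono (by linarith) le_rfl h)
  have hmb : (-1 : ℂ) ∉ rays (-θ) (-θ) := fun h => hm (rays_mono le_rfl (by linarith) h)
  have hsa := rays_subset_compl_closedSector hν0 hν' hθ.le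
  have hsb := rays_neg_subset_compl_closedSector hν0 hν' hθ.le
  have heq : ∀ S ⊆ (closedSector ν)ᶜ, (-1 : ℂ) ∉ S → ∀ z ∈ S, (-1 - z)⁻¹ • resolventOp A z =
      F z + pairKernel 1 z • resolventOp A (-1) := fun S hS hS1 z hz => by
    rw [hFeq z (hS hz) (ne_of_mem_of_not_mem hz hS1), neg_smul, neg_add_cancel_right]
  rw [contourOp_eq, contourIntegral_congr (heq _ hsa hma) (heq _ hsb hmb),
    contourIntegral_add (hdecay _ hsa) (hK _ hsa hma) (hdecay _ hsb) (hK _ hsb hmb), hzero,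
    contourIntegral_smul_const, hk, zero_add, inv_smul_smul₀ Complex.two_pi_I_ne_zero]

end

section

/-! ### Multiplicativity of the functional calculus -/

/-! ### Exchange of two path integrals -/

section Fubini

variable {E : Type*} [NormedAddCommGroup E] [NormedSpace ℂ E]

theorem contourIntegral_smul (c : ℂ) (F : ℂ → E) (θ : ℝ) :
    contourIntegral (fun z => c • F z) θ = c • contourIntegral F θ := by
  simp only [contourIntegral, rayIntegral, smul_comm _ c, smul_sub, integral_smul]

theorem rayIntegral_contourIntegral {H : ℂ → ℂ → E} {a θ : ℝ}
    (h : ∀ b, b = θ ∨ b = -θ → Integrable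
      (fun p : ℝ × ℝ => H (rayPoint a p.1) (rayPoint b p.2))
      ((volume.restrict (Ioi 0)).prod (volume.restrict (Ioi 0)))) :
    rayIntegral (fun w => contourIntegral (H w) θ) a =
      rayIntegral (fun w => rayIntegral (H w) (-θ)) a -
        rayIntegral (fun w => rayIntegral (H w) θ) a := by
  simp only [rayIntegral, contourIntegral, smul_sub, integral_smul]
  have hi : ∀ b, b = θ ∨ b = -θ → Integrable (fun r => Complex.exp (a * Complex.I) •
      Complex.exp (b * Complex.I) • ∫ s in Ioi (0 : ℝ), H (rayPoint a r) (rayPoint b s))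
      (volume.restrict (Ioi 0)) := fun b hb =>
    Integrable.smul (Complex.exp (a * Complex.I))
      (Integrable.smul (Complex.exp (b * Complex.I)) (h b hb).integral_prod_left)
  simpa only [integral_smul] using integral_sub (hi _ (Or.inr rfl)) (hi _ (Or.inl rfl))

theorem rayIntegral_rayIntegral_swap {H : ℂ → ℂ → E} {a b : ℝ}
    (h : Integrable (fun p : ℝ × ℝ => H (rayPoint a p.1) (rayPoint b p.2))
      ((volume.restrict (Ioi 0)).prod (volume.restrict (Ioi 0)))) :
    rayIntegral (fun w => rayIntegral (H w) b) a =
      rayIntegral (fun z => rayIntegral (fun w => H w z) a) b := by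
  simp only [rayIntegral, integral_smul]
  rw [smul_comm]
  congr 2
  exact integral_integral_swap h

theorem contourIntegral_contourIntegral_swap {H : ℂ → ℂ → E} {θ θ' : ℝ}
    (h : ∀ a, (a = θ' ∨ a = -θ') → ∀ b, (b = θ ∨ b = -θ) → Integrable
      (fun p : ℝ × ℝ => H (rayPoint a p.1) (rayPoint b p.2))
      ((volume.restrict (Ioi 0)).prod (volume.restrict (Ioi 0)))) :
    contourIntegral (fun w => contourIntegral (H w) θ) θ' =
      contourIntegral (fun z => contourIntegral (fun w => H w z) θ') θ := by
  have hr : ∀ b, (b = θ ∨ b = -θ) → rayIntegral (fun z => contourIntegral (fun w => H w z) θ') b =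
      rayIntegral (fun z => rayIntegral (fun w => H w z) (-θ')) b -
        rayIntegral (fun z => rayIntegral (fun w => H w z) θ') b := fun b hb =>
    rayIntegral_contourIntegral (H := fun z w => H w z) fun a ha => (h a ha b hb).swap
  rw [contourIntegral, rayIntegral_contourIntegral (h _ (Or.inl rfl)),
    rayIntegral_contourIntegral (h _ (Or.inr rfl)), contourIntegral, hr _ (Or.inl rfl),
    hr _ (Or.inr rfl), rayIntegral_rayIntegral_swap (h _ (Or.inl rfl) _ (Or.inl rfl)),
    rayIntegral_rayIntegral_swap (h _ (Or.inl rfl) _ (Or.inr rfl)),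
    rayIntegral_rayIntegral_swap (h _ (Or.inr rfl) _ (Or.inl rfl)),
    rayIntegral_rayIntegral_swap (h _ (Or.inr rfl) _ (Or.inr rfl))]
  abel

end Fubini

theorem normSq_rayPoint_sub (a b r s : ℝ) : ‖rayPoint a r - rayPoint b s‖ ^ 2 =
    r ^ 2 + s ^ 2 - 2 * r * s * Real.cos (a - b) := by
  rw [← Complex.normSq_eq_norm_sq, Complex.normSq_apply]
  have h1 : ∀ θ r : ℝ, (rayPoint θ r).re = r * Real.cos θ := fun θ r => by
    rw [rayPoint, Complex.re_ofReal_mul, Complex.exp_ofReal_mul_I_re]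
  have h2 : ∀ θ r : ℝ, (rayPoint θ r).im = r * Real.sin θ := fun θ r => by
    rw [rayPoint, Complex.im_ofReal_mul, Complex.exp_ofReal_mul_I_im]
  rw [Complex.sub_re, Complex.sub_im, h1, h1, h2, h2, Real.cos_sub]
  linear_combination r ^ 2 * Real.sin_sq_add_cos_sq a + s ^ 2 * Real.sin_sq_add_cos_sq b

/-- On two different rays |w - z| ≥ c(r + s), with c² = (1 - cos(a - b))/2, and the weighted mean
inequality gives r + s ≥ r^p s^(1-p). The Cauchy kernel is thus dominated by a product of functions
of r and of s. -/
theorem norm_inv_rayPoint_sub_le {a b : ℝ} (h : Real.cos (a - b) ≠ 1) {p : ℝ} (hp : 0 ≤ p)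
    (hp' : p ≤ 1) : ∃ K : ℝ, ∀ r s : ℝ, 0 < r → 0 < s →
      ‖(rayPoint a r - rayPoint b s)⁻¹‖ ≤ K * (r ^ (-p) * s ^ (p - 1)) := by
  have hc : 0 < (1 - Real.cos (a - b)) / 2 := by
    have := (Real.cos_le_one (a - b)).lt_of_ne h
    linarith
  set c := Real.sqrt ((1 - Real.cos (a - b)) / 2) with hcdef
  have hc0 : 0 < c := Real.sqrt_pos.2 hc
  refine ⟨c⁻¹, fun r s hr hs => ?_⟩
  have h1 : c * (r + s) ≤ ‖rayPoint a r - rayPoint b s‖ := by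
    refine abs_le_of_sq_le_sq' ?_ (norm_nonneg _) |>.2
    rw [normSq_rayPoint_sub, mul_pow, hcdef, Real.sq_sqrt hc.le]
    nlinarith [mul_nonneg (by linarith [Real.neg_one_le_cos (a - b)] :
      0 ≤ 1 + Real.cos (a - b)) (sq_nonneg (r - s))]
  have h2 : r ^ p * s ^ (1 - p) ≤ r + s := by
    have := Real.geom_mean_le_arith_mean2_weighted hp (by linarith : 0 ≤ 1 - p) hr.le hs.le
      (by ring)
    nlinarith
  have h3 : c * (r ^ p * s ^ (1 - p)) ≤ ‖rayPoint a r - rayPoint b s‖ :=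
    (mul_le_mul_of_nonneg_left h2 hc0.le).trans h1
  rw [norm_inv]
  refine (inv_anti₀ (by positivity) h3).trans_eq ?_
  rw [mul_inv, mul_inv, Real.rpow_neg hr.le, ← Real.rpow_neg hs.le, neg_sub]

variable {X : Type*} [NormedAddCommGroup X] [NormedSpace ℂ X] {A : X →ₗ.[ℂ] X} {ω γ : ℝ}

theorem integrableOn_rpow_smul {E : Type*} [NormedAddCommGroup E] [NormedSpace ℂ E] {F : ℂ → E}
    {a p q s : ℝ} (hF : ∀ z ∈ rays a a, DifferentiableAt ℂ F z)
    (h0 : F =O[𝓝[rays a a] 0] fun z => ‖z‖ ^ p) (hp : -1 < s + p)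
    (h1 : F =O[Bornology.cobounded ℂ ⊓ 𝓟 (rays a a)] fun z => ‖z‖ ^ q) (hq : s + q < -1) :
    IntegrableOn (fun r : ℝ => ((r ^ s : ℝ) : ℂ) • F (rayPoint a r)) (Ioi 0) := by
  have ha : a ∈ Icc a a := ⟨le_rfl, le_rfl⟩
  have hr : ∀ l : Filter ℝ, (fun r : ℝ => ((r ^ s : ℝ) : ℂ)) =O[l] fun r => r ^ s := fun l =>
    Asymptotics.IsBigO.of_bound 1 (Eventually.of_forall fun r => by simp)
  refine integrableOn_Ioi_of_isBigO_rpow (p := -(s + p)) (q := -(s + q)) ?_ (by linarith) ?_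
    (by linarith) ?_
  · exact (Complex.continuous_ofReal.comp_continuousOn fun r hr =>
      (Real.continuousAt_rpow_const r s (Or.inl (ne_of_gt hr))).continuousWithinAt).smul
        (continuousOn_comp_rayPoint hF ha)
  · refine ((hr _).smul (isBigO_rayPoint_zero h0 ha)).congr' EventuallyEq.rfl ?_
    filter_upwards [self_mem_nhdsWithin] with r hr
    rw [neg_neg, Real.rpow_add hr, smul_eq_mul]
  · refine ((hr _).smul (isBigO_rayPoint_atTop h1 ha)).congr' EventuallyEq.rfl ?_
    filter_upwards [eventually_gt_atTop 0] with r hr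
    rw [neg_neg, Real.rpow_add hr, smul_eq_mul]

theorem integrable_kernel (hA : IsAlmostSectorial A ω γ) (hω : 0 ≤ ω) (hγ : -1 < γ)
    (hγ' : γ < 0) {f g : ℂ → ℂ} {a b ν : ℝ} (hab : Real.cos (a - b) ≠ 1)
    (hf : SectorDecay (rays a a) f) (hg : SectorDecay (rays b b) g) (hν : ω < ν)
    (hν' : ν < Real.pi) (hb : rays b b ⊆ (closedSector ν)ᶜ) :
    Integrable (fun p : ℝ × ℝ => (f (rayPoint a p.1) *
      (g (rayPoint b p.2) * (rayPoint a p.1 - rayPoint b p.2)⁻¹)) • resolventOp A (rayPoint b p.2))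
      ((volume.restrict (Ioi 0)).prod (volume.restrict (Ioi 0))) := by
  -- The midpoint of (-γ, 1): p < 1 makes r^(-p) integrable at 0, and p > -γ does the same for
  -- s^(p-1+γ).
  set p : ℝ := (1 - γ) / 2 with hp
  set G : ℂ → X →L[ℂ] X := fun z => g z • resolventOp A z with hG
  have hGd := hg.rayDecay_smul hA hω hγ hγ' hν hν' hb
  have hR := fun l (hl : rays b b ∈ l) => hA.exists_isBigO hν hν' hb hl
  have h1 : IntegrableOn (fun r : ℝ => ((r ^ (-p) : ℝ) : ℂ) • f (rayPoint a r)) (Ioi 0) :=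
    integrableOn_rpow_smul (p := 0) (q := -1) hf.diff (by simpa using hf.zero)
      (by rw [hp]; linarith) hf.infty (by rw [hp]; linarith)
  have h2 : IntegrableOn (fun r : ℝ => ((r ^ (p - 1) : ℝ) : ℂ) • G (rayPoint b r)) (Ioi 0) := by
    refine integrableOn_rpow_smul (p := γ) (q := -1 + γ) hGd.diff ?_ (by rw [hp]; linarith) ?_
      (by rw [hp]; linarith)
    · simpa using hg.zero.smul (hR _ self_mem_nhdsWithin)
    · exact isBigO_mul_cobounded hg.infty (hR _ (mem_inf_of_right (mem_principal_self _)))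
  obtain ⟨K, hK⟩ := norm_inv_rayPoint_sub_le hab (p := p) (by rw [hp]; linarith)
    (by rw [hp]; linarith)
  have hprod := (h1.norm.mul_prod h2.norm).const_mul K
  refine hprod.mono' ?_ ?_
  · have m1 : AEStronglyMeasurable (fun r => f (rayPoint a r)) (volume.restrict (Ioi 0)) :=
      (continuousOn_comp_rayPoint hf.diff ⟨le_rfl, le_rfl⟩).aestronglyMeasurable measurableSet_Ioi
    have m2 : AEStronglyMeasurable (fun r => G (rayPoint b r)) (volume.restrict (Ioi 0)) :=
      (continuousOn_comp_rayPoint hGd.diff ⟨le_rfl, le_rfl⟩).aestronglyMeasurable measurableSet_Ioi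
    have m3 : Measurable fun p : ℝ × ℝ => (rayPoint a p.1 - rayPoint b p.2)⁻¹ :=
      (((continuous_rayPoint a).comp continuous_fst).sub
        ((continuous_rayPoint b).comp continuous_snd)).measurable.inv
    have := (m1.comp_fst (ν := volume.restrict (Ioi 0))).smul
      (m3.aestronglyMeasurable.smul (m2.comp_snd (μ := volume.restrict (Ioi 0))))
    refine this.congr (Eventually.of_forall fun p => ?_)
    simp only [hG, Pi.smul_apply', smul_smul]
    congr 1
    ring
  · rw [Measure.prod_restrict]
    filter_upwards [ae_restrict_mem (measurableSet_Ioi.prod measurableSet_Ioi)] with x hx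
    have hx1 : 0 < x.1 := hx.1
    have hx2 : 0 < x.2 := hx.2
    simp only [hG, norm_smul, norm_mul, Complex.norm_real, Real.norm_eq_abs,
      abs_of_pos (Real.rpow_pos_of_pos hx1 _), abs_of_pos (Real.rpow_pos_of_pos hx2 _)]
    calc _ = ‖(rayPoint a x.1 - rayPoint b x.2)⁻¹‖ * (‖f (rayPoint a x.1)‖ *
          (‖g (rayPoint b x.2)‖ * ‖resolventOp A (rayPoint b x.2)‖)) := by ring
      _ ≤ K * (x.1 ^ (-p) * x.2 ^ (p - 1)) * (‖f (rayPoint a x.1)‖ *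
          (‖g (rayPoint b x.2)‖ * ‖resolventOp A (rayPoint b x.2)‖)) := by
        gcongr
        exact hK _ _ hx1 hx2
      _ = _ := by ring

theorem cos_ne_one_of_abs_lt {x : ℝ} (h : x ≠ 0) (h' : |x| < Real.pi) : Real.cos x ≠ 1 := by
  have := Real.pi_pos
  rw [Ne, Real.cos_eq_one_iff_of_lt_of_lt (by linarith [(abs_lt.1 h').1])
    (by linarith [(abs_lt.1 h').2])]
  exact h

variable [CompleteSpace X]

/-- The functional calculus is multiplicative. -/
theorem contourOp_mul (hA : IsAlmostSectorial A ω γ) (hω : 0 ≤ ω) (hγ : -1 < γ) (hγ' : γ < 0)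
    {f g : ℂ → ℂ} {μ θ : ℝ} (hμ : μ ≤ Real.pi / 2) (hf : SectorDecay (rays (-μ) μ) f)
    (hg : SectorDecay (rays (-μ) μ) g) (hωθ : ω < θ) (hθ : θ ≤ μ) :
    contourOp A f θ * contourOp A g θ = contourOp A (fun z => f z * g z) θ := by
  have hpi := Real.pi_pos
  have hμ' : μ ≤ Real.pi := by linarith
  -- The operators do not depend on θ, so the inner path can be taken strictly inside the outer one,
  -- Γ_μ.
  wlog hlt : θ < μ generalizing θ
  · obtain ⟨θ', h1, h2⟩ := exists_between (hωθ.trans_le hθ)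
    have := this h1 h2.le h2
    rwa [hf.contourOp_eq_contourOp hA hω hγ hγ' hμ' h1 h2.le hωθ hθ,
      hg.contourOp_eq_contourOp hA hω hγ hγ' hμ' h1 h2.le hωθ hθ,
      (hf.mul hg).contourOp_eq_contourOp hA hω hγ hγ' hμ' h1 h2.le hωθ hθ] at this
  obtain ⟨ν, hων, hνθ⟩ := exists_between hωθ
  have hν0 : 0 ≤ ν := by linarith
  have hθπ : θ ≤ Real.pi := by linarith
  have hsub : ∀ b, b = θ ∨ b = -θ → rays b b ⊆ (closedSector ν)ᶜ := by
    rintro b (rfl | rfl)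
    · exact rays_subset_compl_closedSector hν0 hνθ hθπ
    · exact rays_neg_subset_compl_closedSector hν0 hνθ hθπ
  have hout : ∀ a, (a = μ ∨ a = -μ) → ∀ r : ℝ, 0 < r → rayPoint a r ∉ rays (-θ) θ ∧
      rayPoint a r ∈ resolventSet A := by
    intro a ha r hr
    have h1 : |a| = μ := by
      rcases ha with rfl | rfl
      · exact abs_of_nonneg (by linarith)
      · rw [abs_neg, abs_of_nonneg (by linarith)]
    exact ⟨notMem_rays_of_abs_lt hr (by rwa [h1]) (by rwa [h1]),
      hA.mem_resolventSet le_rfl (notMem_closedSector_iff.2 ⟨rayPoint_ne_zero hr,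
        by rw [abs_arg_rayPoint (by rwa [h1]) hr, h1]; linarith⟩)⟩
  have hgθ : SectorDecay (rays (-θ) θ) g := hg.mono (rays_mono (by linarith) hθ)
  have hfR := hf.rayDecay_rays hA hω hγ hγ' hμ' (hωθ.trans hlt) le_rfl le_rfl
  -- With w on the outer path Γ_μ and z on the inner path Γ_θ, R(w)g(A) is the integral of g(z)(w -
  -- z)⁻¹R(z), since w lies outside the inner sector. After the exchange of integrals, the
  -- w-integral is evaluated by Cauchy's formula.
  set c : ℂ := (2 * Real.pi * Complex.I)⁻¹ with hc
  have hstep : ∀ a, (a = μ ∨ a = -μ) → ∀ w ∈ rays a a,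
      (f w • resolventOp A w) * contourOp A g θ =
      c • contourIntegral (fun z => (f w * (g z * (w - z)⁻¹)) • resolventOp A z) θ := by
    rintro a ha w ⟨a', ha', r, hr, rfl⟩
    obtain rfl := le_antisymm ha'.2 ha'.1
    obtain ⟨h1, h2⟩ := hout a' ha r hr
    rw [smul_mul_assoc, resolventOp_mul_contourOp hA hω hγ hγ' hgθ hθπ hωθ h2
      (rayPoint_ne_zero hr) h1, contourOp_eq, smul_comm]
    congr 1
    simp only [mul_smul (f _), contourIntegral_smul]
  rw [hf.contourOp_eq_contourOp hA hω hγ hγ' hμ' hωθ hθ (hωθ.trans hlt) le_rfl, contourOp_eq,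
    smul_mul_assoc]
  change c • (ContinuousLinearMap.mul ℂ (X →L[ℂ] X)).flip (contourOp A g θ) _ = _
  rw [← contourIntegral_clm _ hfR.1 hfR.2]
  simp only [ContinuousLinearMap.flip_apply, ContinuousLinearMap.mul_apply']
  rw [contourIntegral_congr (hstep _ (Or.inl rfl)) (hstep _ (Or.inr rfl))]
  have hsw := contourIntegral_contourIntegral_swap (θ := θ) (θ' := μ)
    (H := fun w z => (f w * (g z * (w - z)⁻¹)) • resolventOp A z) ?_
  · rw [contourIntegral_smul, hsw, contourOp_eq]
    congr 1
    rw [← contourIntegral_smul]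
    have hz : ∀ b, (b = θ ∨ b = -θ) → ∀ z ∈ rays b b,
        c • contourIntegral (fun w => (f w * (g z * (w - z)⁻¹)) • resolventOp A z) μ =
        (f z * g z) • resolventOp A z := by
      rintro b hb z ⟨b', hb', r, hr, rfl⟩
      obtain rfl := le_antisymm hb'.2 hb'.1
      have h1 : |b'| = θ := by
        rcases hb with rfl | rfl
        · exact abs_of_nonneg (by linarith)
        · rw [abs_neg, abs_of_nonneg (by linarith)]
      -- The restriction μ ≤ π/2, together with θ < μ, gives μ < π - θ, so that -z stays outside the
      -- outer sector.
      have h2 := hf.contourIntegral_cauchy hr (by rwa [h1]) (by rw [h1]; linarith)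
      have h3 : ∀ w, f w * (g (rayPoint b' r) * (w - rayPoint b' r)⁻¹) =
          -g (rayPoint b' r) * (f w * (rayPoint b' r - w)⁻¹) := fun w => by
        rw [← neg_sub, inv_neg]
        ring
      rw [contourIntegral_smul_const]
      simp only [h3]
      rw [contourIntegral_const_mul, h2, smul_smul, hc]
      congr 1
      field_simp [Complex.two_pi_I_ne_zero]
    exact contourIntegral_congr (hz _ (Or.inl rfl)) (hz _ (Or.inr rfl))
  · intro a ha b hb
    have hab : a - b ≠ 0 ∧ |a - b| < Real.pi := by
      rcases ha with rfl | rfl <;> rcases hb with rfl | rfl <;>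
        refine ⟨?_, abs_lt.2 ⟨by linarith, by linarith⟩⟩
      · exact (by linarith : 0 < a - b).ne'
      · exact (by linarith : 0 < a - -θ).ne'
      · exact (by linarith : -μ - b < 0).ne
      · exact (by linarith : -μ - -θ < 0).ne
    refine integrable_kernel hA hω hγ hγ' (cos_ne_one_of_abs_lt hab.1 hab.2)
      (hf.mono (rays_mono ?_ ?_)) (hg.mono (rays_mono ?_ ?_)) hων (by linarith) (hsub b hb)
    · rcases ha with rfl | rfl <;> linarith
    · rcases ha with rfl | rfl <;> linarith
    · rcases hb with rfl | rfl <;> linarith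
    · rcases hb with rfl | rfl <;> linarith

end

section

/-! ### The functions `e^{-t z^α}`, `z^α e^{-t z^α}` and `z^α (1 + z)⁻ⁿ` -/

theorem cpow_rayPoint {ψ r : ℝ} (hψ : ψ ∈ Ioc (-Real.pi) Real.pi) (hr : 0 < r) (α : ℝ) :
    rayPoint ψ r ^ (α : ℂ) = rayPoint (α * ψ) (r ^ α) := by
  rw [Complex.cpow_def_of_ne_zero (rayPoint_ne_zero hr), Complex.log, arg_rayPoint hψ hr,
    norm_rayPoint, abs_of_pos hr, add_mul, Complex.exp_add, rayPoint, Real.rpow_def_of_pos hr]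
  push_cast
  ring_nf

theorem rayPoint_mul_rayPoint (a b r s : ℝ) :
    rayPoint a r * rayPoint b s = rayPoint (a + b) (r * s) := by
  simp only [rayPoint, Complex.ofReal_mul, Complex.ofReal_add, add_mul, Complex.exp_add]
  ring

theorem rayPoint_re (θ r : ℝ) : (rayPoint θ r).re = r * Real.cos θ := by
  rw [rayPoint, Complex.re_ofReal_mul, Complex.exp_ofReal_mul_I_re]

theorem mul_cpow_re {t : ℂ} {ψ r : ℝ} (hψ : ψ ∈ Ioc (-Real.pi) Real.pi) (hr : 0 < r) (α : ℝ) :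
    (t * rayPoint ψ r ^ (α : ℂ)).re = ‖t‖ * Real.cos (t.arg + α * ψ) * r ^ α := by
  conv_lhs => rw [cpow_rayPoint hψ hr, ← rayPoint_arg t, rayPoint_mul_rayPoint, rayPoint_re]
  ring

/-- The argument of t z^α is at most |arg t| + αθ < π/2 in absolute value, so its cosine is bounded
below on the whole sector. -/
theorem exists_le_mul_cpow_re {α θ : ℝ} (hα : 0 < α) (hθ : θ < Real.pi) {t : ℂ}
    (ht : t ∈ openSector (Real.pi / 2 - α * θ)) :
    ∃ c : ℝ, 0 < c ∧ ∀ z ∈ rays (-θ) θ, c * ‖z‖ ^ α ≤ (t * z ^ (α : ℂ)).re := by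
  by_cases hθ0 : 0 ≤ θ
  · have h0 : 0 < Real.cos (|t.arg| + α * θ) := by
      refine Real.cos_pos_of_mem_Ioo ⟨?_, by linarith [ht.2]⟩
      have := mul_nonneg hα.le hθ0
      linarith [abs_nonneg t.arg, Real.pi_pos]
    refine ⟨‖t‖ * Real.cos (|t.arg| + α * θ), mul_pos (norm_pos_iff.2 ht.1) h0, ?_⟩
    rintro z ⟨ψ, hψ, r, hr, rfl⟩
    rw [mul_cpow_re ⟨by linarith [hψ.1], by linarith [hψ.2]⟩ hr, norm_rayPoint, abs_of_pos hr]
    gcongr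
    rw [← Real.cos_abs (t.arg + α * ψ)]
    refine Real.cos_le_cos_of_nonneg_of_le_pi (abs_nonneg _) ?_ ?_
    · linarith [ht.2, Real.pi_pos]
    · refine (abs_add_le _ _).trans ?_
      rw [abs_mul, abs_of_pos hα]
      gcongr
      exact abs_le.2 hψ
  -- For θ < 0 there are no rays, and any constant serves.
  · refine ⟨1, one_pos, ?_⟩
    rintro z ⟨ψ, hψ, -⟩
    linarith [hψ.1, hψ.2]

theorem norm_expFun (α : ℝ) (t z : ℂ) : ‖expFun α t z‖ = Real.exp (-(t * z ^ (α : ℂ)).re) := by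
  rw [expFun, Complex.norm_exp, neg_mul, Complex.neg_re]

theorem differentiableAt_expFun {α : ℝ} {t z : ℂ} (hz : z ∈ Complex.slitPlane) :
    DifferentiableAt ℂ (expFun α t) z :=
  (((hasDerivAt_id z).cpow_const hz).differentiableAt.const_mul (-t)).cexp

theorem differentiableAt_cpow {α : ℝ} {z : ℂ} (hz : z ∈ Complex.slitPlane) :
    DifferentiableAt ℂ (fun z : ℂ => z ^ (α : ℂ)) z :=
  ((hasDerivAt_id z).cpow_const hz).differentiableAt

theorem isBigO_norm_rpow_zero_one {β : ℝ} (hβ : 0 ≤ β) (S : Set ℂ) :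
    (fun z : ℂ => ‖z‖ ^ β) =O[𝓝[S] 0] fun _ => (1 : ℝ) :=
  ((continuous_norm.rpow_const fun _ => Or.inr hβ).tendsto 0).isBigO_one ℝ |>.mono
    nhdsWithin_le_nhds

/-- Functions dominated by `‖z‖^β e^{-c ‖z‖^α}`. -/
theorem SectorDecay.of_norm_le_exp {S : Set ℂ} {f : ℂ → ℂ} {α β c : ℝ}
    (hd : ∀ z ∈ S, DifferentiableAt ℂ f z) (hα : 0 < α) (hβ : 0 ≤ β) (hc : 0 < c)
    (h : ∀ z ∈ S, ‖f z‖ ≤ ‖z‖ ^ β * Real.exp (-c * ‖z‖ ^ α)) : SectorDecay S f where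
  diff := hd
  zero := by
    refine Asymptotics.IsBigO.trans (Asymptotics.IsBigO.of_bound 1 ?_)
      (isBigO_norm_rpow_zero_one hβ S)
    filter_upwards [self_mem_nhdsWithin] with z hz
    rw [one_mul, Real.norm_of_nonneg (by positivity)]
    refine (h z hz).trans (mul_le_of_le_one_right (by positivity) (Real.exp_le_one_iff.2 ?_))
    have : 0 ≤ c * ‖z‖ ^ α := by positivity
    linarith
  infty := by
    have h1 : (fun x : ℝ => x ^ β * Real.exp (-c * x ^ α)) =O[atTop] fun x => x ^ (-1 : ℝ) := by
      have h2 := ((isLittleO_exp_neg_mul_rpow_atTop hc ((-1 - β) / α)).comp_tendsto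
        (tendsto_rpow_atTop hα)).isBigO
      refine ((Asymptotics.isBigO_refl (fun x : ℝ => x ^ β) atTop).mul h2).congr'
        EventuallyEq.rfl ?_
      filter_upwards [eventually_gt_atTop 0] with x hx
      simp only [Function.comp_apply]
      rw [← Real.rpow_mul hx.le, ← Real.rpow_add hx, mul_div_cancel₀ _ hα.ne']
      congr 1
      ring
    have h3 := (h1.comp_tendsto (tendsto_norm_cobounded_atTop (E := ℂ))).mono
      (inf_le_left (b := 𝓟 S))
    refine Asymptotics.IsBigO.trans (Asymptotics.IsBigO.of_bound 1 ?_) h3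
    filter_upwards [mem_inf_of_right (mem_principal_self S)] with z hz
    rw [one_mul]
    exact (h z hz).trans (le_abs_self _)

theorem sectorDecay_expFun {α θ : ℝ} (hα : 0 < α) (hθ : θ < Real.pi) {t : ℂ}
    (ht : t ∈ openSector (Real.pi / 2 - α * θ)) : SectorDecay (rays (-θ) θ) (expFun α t) := by
  obtain ⟨c, hc, hb⟩ := exists_le_mul_cpow_re hα hθ ht
  refine SectorDecay.of_norm_le_exp (β := 0)
    (fun z hz => differentiableAt_expFun (mem_slitPlane_of_mem_rays hθ hz)) hα le_rfl hc
    fun z hz => ?_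
  rw [norm_expFun, Real.rpow_zero, one_mul, neg_mul]
  exact Real.exp_le_exp.2 (neg_le_neg (hb z hz))

/-- The function `z^α e^{-t z^α}`. -/
def powExpFun (α : ℝ) (t z : ℂ) : ℂ := z ^ (α : ℂ) * expFun α t z

theorem sectorDecay_powExpFun {α θ : ℝ} (hα : 0 < α) (hθ : θ < Real.pi) {t : ℂ}
    (ht : t ∈ openSector (Real.pi / 2 - α * θ)) : SectorDecay (rays (-θ) θ) (powExpFun α t) := by
  obtain ⟨c, hc, hb⟩ := exists_le_mul_cpow_re hα hθ ht
  refine SectorDecay.of_norm_le_exp (β := α) (fun z hz => ?_) hα hα.le hc fun z hz => ?_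
  · have := mem_slitPlane_of_mem_rays hθ hz
    exact (differentiableAt_cpow this).mul (differentiableAt_expFun this)
  · rw [powExpFun, norm_mul, norm_expFun, Complex.norm_cpow_real, neg_mul]
    gcongr
    exact hb z hz

theorem neg_one_notMem_rays {θ : ℝ} (hθ : θ < Real.pi) : (-1 : ℂ) ∉ rays (-θ) θ := by
  rw [← rayPoint_pi_one]
  exact notMem_rays_of_abs_lt one_pos (by rw [abs_of_pos Real.pi_pos])
    (by rwa [abs_of_pos Real.pi_pos])

theorem sectorDecay_inv_neg_one_sub {θ : ℝ} (hθ : θ < Real.pi) :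
    SectorDecay (rays (-θ) θ) fun z => (-1 - z)⁻¹ :=
  sectorDecay_inv_sub (by simp) (neg_one_notMem_rays hθ)

theorem inv_one_add_eq (z : ℂ) : (1 + z)⁻¹ = -1 * (-1 - z)⁻¹ := by
  rw [show -1 - z = -(1 + z) by ring, inv_neg]
  ring

theorem sectorDecay_inv_one_add {θ : ℝ} (hθ : θ < Real.pi) :
    SectorDecay (rays (-θ) θ) fun z => (1 + z)⁻¹ := by
  simpa only [inv_one_add_eq] using (sectorDecay_inv_neg_one_sub hθ).const_mul (-1)

/-- The exponent ⌈α⌉ + 1 is at least α + 1, which is what leaves the decay O(1/|z|) at infinity. -/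
theorem sectorDecay_regPow {α θ : ℝ} (hα : 0 < α) (hθ : θ < Real.pi) :
    SectorDecay (rays (-θ) θ) (regPow α) := by
  have h := sectorDecay_inv_one_add hθ
  have hreg : regPow α = fun z => z ^ (α : ℂ) * ((1 + z)⁻¹) ^ regExponent α :=
    funext fun z => by rw [regPow, inv_pow]
  have hpow : ∀ l : Filter ℂ, (fun z : ℂ => z ^ (α : ℂ)) =O[l] fun z => ‖z‖ ^ α := fun l =>
    Asymptotics.IsBigO.of_bound 1 (Eventually.of_forall fun z => by
      rw [Complex.norm_cpow_real, one_mul]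
      exact le_abs_self _)
  rw [hreg]
  refine ⟨fun z hz => ?_, ?_, ?_⟩
  · exact (differentiableAt_cpow (mem_slitPlane_of_mem_rays hθ hz)).mul ((h.diff z hz).pow _)
  · simpa using ((hpow _).trans (isBigO_norm_rpow_zero_one hα.le _)).mul
      (h.zero.pow (regExponent α))
  · have h1 := ((hpow _).mul (h.infty.pow (regExponent α)))
    refine h1.trans (Asymptotics.IsBigO.trans (Asymptotics.IsBigO.of_bound 1 ?_)
      (isBigO_norm_rpow_cobounded (p := α - regExponent α) (q := -1) ?_ _))
    · filter_upwards [eventually_ne_zero_cobounded _] with z hz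
      rw [one_mul, ← Real.rpow_natCast, ← Real.rpow_mul hz.le, ← Real.rpow_add hz, neg_one_mul,
        sub_eq_add_neg]
    · have := Nat.le_ceil α
      rw [regExponent]
      push_cast
      linarith

/-! ### Admissible angles and the geometry of the sectors -/

theorem lt_angleBound_iff {α θ : ℝ} (hα : 0 < α) {t : ℂ} (ht : t ≠ 0) :
    θ < angleBound α t ↔ θ < Real.pi ∧ t ∈ openSector (Real.pi / 2 - α * θ) := by
  rw [angleBound, lt_min_iff, lt_div_iff₀ (by positivity), openSector, mem_ofPred_eq]
  refine and_congr_right fun _ => ⟨fun h => ⟨ht, by linarith⟩, fun h => by linarith [h.2]⟩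

/-- The sector of half-angle π/2 - δ is the intersection of the half-planes obtained by rotating Re
t > 0 by ±δ. Convexity and stability under addition follow from this. -/
theorem mem_openSector_iff {δ : ℝ} (h0 : 0 ≤ δ) (h1 : δ < Real.pi / 2) {t : ℂ} :
    t ∈ openSector (Real.pi / 2 - δ) ↔
      0 < (t * Complex.exp (δ * Complex.I)).re ∧
        0 < (t * Complex.exp ((-δ : ℝ) * Complex.I)).re := by
  have hre : ∀ x : ℝ, (t * Complex.exp (x * Complex.I)).re = ‖t‖ * Real.cos (t.arg + x) := by
    intro x
    have : Complex.exp (x * Complex.I) = rayPoint x 1 := by simp [rayPoint]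
    conv_lhs => rw [this, ← rayPoint_arg t, rayPoint_mul_rayPoint, rayPoint_re, mul_one]
  rw [hre, hre]
  constructor
  · rintro ⟨ht, h⟩
    have h2 := abs_lt.1 h
    exact ⟨mul_pos (norm_pos_iff.2 ht) (Real.cos_pos_of_mem_Ioo ⟨by linarith, by linarith⟩),
      mul_pos (norm_pos_iff.2 ht) (Real.cos_pos_of_mem_Ioo ⟨by linarith, by linarith⟩)⟩
  · rintro ⟨ha, hb⟩
    have ht : t ≠ 0 := by
      rintro rfl
      simp at ha
    have hn := norm_pos_iff.2 ht
    have ha' := pos_of_mul_pos_right ha hn.le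
    have hb' := pos_of_mul_pos_right hb hn.le
    -- The sum of the two cosines is 2 cos(arg t) cos δ, which first confines arg t to (-π/2, π/2).
    have hsum : 0 < Real.cos t.arg * Real.cos δ := by
      rw [Real.cos_add, Real.cos_neg, Real.sin_neg] at *
      linarith
    have hδ : 0 < Real.cos δ := Real.cos_pos_of_mem_Ioo ⟨by linarith, h1⟩
    have harg : |t.arg| < Real.pi / 2 := by
      rw [Complex.abs_arg_lt_pi_div_two_iff]
      left
      rw [← Complex.norm_mul_cos_arg]
      exact mul_pos hn (pos_of_mul_pos_left hsum hδ.le)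
    have h3 : ∀ x : ℝ, |x| ≤ δ → 0 < Real.cos (t.arg + x) → t.arg + x < Real.pi / 2 ∧
        -(Real.pi / 2) < t.arg + x := by
      intro x hx hpos
      have := abs_lt.1 harg
      have hx' := abs_le.1 hx
      constructor
      · by_contra! hge
        exact hpos.not_ge (Real.cos_nonpos_of_pi_div_two_le_of_le hge (by linarith))
      · by_contra! hge
        rw [← Real.cos_neg] at hpos
        exact hpos.not_ge (Real.cos_nonpos_of_pi_div_two_le_of_le (by linarith) (by linarith))
    have h4 := h3 δ (abs_of_nonneg h0).le ha'
    have h5 := h3 (-δ) (by rw [abs_neg, abs_of_nonneg h0]) hb'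
    exact ⟨ht, abs_lt.2 ⟨by linarith [h5.2], by linarith [h4.1]⟩⟩

theorem convex_openSector {δ : ℝ} (h0 : 0 ≤ δ) (h1 : δ < Real.pi / 2) :
    Convex ℝ (openSector (Real.pi / 2 - δ)) := by
  have hl : ∀ x : ℝ, Convex ℝ {t : ℂ | 0 < (t * Complex.exp (x * Complex.I)).re} := fun x =>
    convex_halfSpace_gt ⟨fun a b => by simp only [add_mul, Complex.add_re],
      fun c a => by rw [smul_mul_assoc, Complex.smul_re]⟩ 0
  have : openSector (Real.pi / 2 - δ) = {t : ℂ | 0 < (t * Complex.exp (δ * Complex.I)).re} ∩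
      {t : ℂ | 0 < (t * Complex.exp ((-δ : ℝ) * Complex.I)).re} :=
    ext fun t => mem_openSector_iff h0 h1
  rw [this]
  exact (hl _).inter (hl _)

theorem real_mul_mem_openSector {μ : ℝ} {t : ℂ} (ht : t ∈ openSector μ) {r : ℝ} (hr : 0 < r) :
    (r : ℂ) * t ∈ openSector μ :=
  ⟨mul_ne_zero (Complex.ofReal_ne_zero.2 hr.ne') ht.1, by rw [Complex.arg_real_mul t hr]; exact ht.2⟩

theorem add_mem_openSector {δ : ℝ} (h0 : 0 ≤ δ) (h1 : δ < Real.pi / 2) {t s : ℂ}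
    (ht : t ∈ openSector (Real.pi / 2 - δ)) (hs : s ∈ openSector (Real.pi / 2 - δ)) :
    t + s ∈ openSector (Real.pi / 2 - δ) := by
  rw [mem_openSector_iff h0 h1] at *
  simp only [add_mul, Complex.add_re]
  exact ⟨add_pos ht.1 hs.1, add_pos ht.2 hs.2⟩

theorem ofReal_mem_openSector {μ : ℝ} (hμ : 0 < μ) {r : ℝ} (hr : 0 < r) :
    (r : ℂ) ∈ openSector μ :=
  ⟨Complex.ofReal_ne_zero.2 hr.ne', by rwa [Complex.arg_ofReal_of_nonneg hr.le, abs_zero]⟩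

end

section

/-! ### The operators `𝒯_α(t)` -/

variable {X : Type*} [NormedAddCommGroup X] [NormedSpace ℂ X] {A : X →ₗ.[ℂ] X} {ω γ α θ : ℝ}

theorem fracSemigroup_eq (hA : IsAlmostSectorial A ω γ) (hω : 0 ≤ ω) (hγ : -1 < γ) (hγ' : γ < 0)
    (hα : 0 < α) {t : ℂ} (ht : t ≠ 0) (hωθ : ω < θ) (hθ : θ < angleBound α t) :
    fracSemigroup A ω α t = contourOp A (expFun α t) θ := by
  have hm : (ω + angleBound α t) / 2 < angleBound α t := by linarith
  -- The larger of the two angles is still admissible, so e^{-tz^α} decays on one sector that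
  -- contains both paths.
  set μ := max θ ((ω + angleBound α t) / 2) with hμ
  obtain ⟨h1, h2⟩ := (lt_angleBound_iff hα ht).1 (max_lt hθ hm)
  exact (sectorDecay_expFun hα h1 h2).contourOp_eq_contourOp hA hω hγ hγ' h1.le (by linarith)
    (le_max_right _ _) hωθ (le_max_left _ _)

/-- The standing assumptions on the operator `A` and on the half-angle `θ` of the path. -/
structure Admissible (A : X →ₗ.[ℂ] X) (ω γ α θ : ℝ) : Prop where
  almostSectorial : IsAlmostSectorial A ω γ
  angle_nonneg : 0 ≤ ω
  neg_one_lt : -1 < γ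
  lt_zero : γ < 0
  pow_pos : 0 < α
  lt_angle : ω < θ
  angle_le : θ ≤ Real.pi / 2

namespace Admissible

theorem angle_lt_pi (h : Admissible A ω γ α θ) : θ < Real.pi := by
  linarith [h.angle_le, Real.pi_pos]

theorem fracSemigroup_eq (h : Admissible A ω γ α θ) {t : ℂ}
    (ht : t ∈ openSector (Real.pi / 2 - α * θ)) :
    fracSemigroup A ω α t = contourOp A (expFun α t) θ :=
  AlmostSectorial.fracSemigroup_eq h.almostSectorial h.angle_nonneg h.neg_one_lt h.lt_zero h.pow_pos
    ht.1 h.lt_angle ((lt_angleBound_iff h.pow_pos ht.1).2 ⟨h.angle_lt_pi, ht⟩)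

theorem neg_one_mem (h : Admissible A ω γ α θ) : (-1 : ℂ) ∈ resolventSet A := by
  refine h.almostSectorial.mem_resolventSet le_rfl
    (rays_subset_compl_closedSector h.angle_nonneg (h.lt_angle.trans h.angle_lt_pi) le_rfl ?_)
  rw [← rayPoint_pi_one]
  exact rayPoint_mem_rays ⟨le_rfl, le_rfl⟩ one_pos

theorem decay_expFun (h : Admissible A ω γ α θ) {t : ℂ}
    (ht : t ∈ openSector (Real.pi / 2 - α * θ)) : SectorDecay (rays (-θ) θ) (expFun α t) :=
  sectorDecay_expFun h.pow_pos h.angle_lt_pi ht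

theorem decay_powExpFun (h : Admissible A ω γ α θ) {t : ℂ}
    (ht : t ∈ openSector (Real.pi / 2 - α * θ)) : SectorDecay (rays (-θ) θ) (powExpFun α t) :=
  sectorDecay_powExpFun h.pow_pos h.angle_lt_pi ht

variable [CompleteSpace X]

theorem mul (h : Admissible A ω γ α θ) {f g : ℂ → ℂ} (hf : SectorDecay (rays (-θ) θ) f)
    (hg : SectorDecay (rays (-θ) θ) g) :
    contourOp A f θ * contourOp A g θ = contourOp A (fun z => f z * g z) θ :=
  contourOp_mul h.almostSectorial h.angle_nonneg h.neg_one_lt h.lt_zero h.angle_le hf hg h.lt_angle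
    le_rfl

theorem commute (h : Admissible A ω γ α θ) {f g : ℂ → ℂ} (hf : SectorDecay (rays (-θ) θ) f)
    (hg : SectorDecay (rays (-θ) θ) g) :
    Commute (contourOp A f θ) (contourOp A g θ) := by
  rw [Commute, SemiconjBy, h.mul hf hg, h.mul hg hf]
  simp only [mul_comm]

theorem contourOp_inv_sub (h : Admissible A ω γ α θ) :
    contourOp A (fun z => (-1 - z)⁻¹) θ = resolventOp A (-1) :=
  AlmostSectorial.contourOp_inv_sub h.almostSectorial h.angle_nonneg h.neg_one_lt h.lt_zero
    h.angle_lt_pi h.lt_angle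

omit [CompleteSpace X] in
theorem contourOp_const_mul (c : ℂ) (f : ℂ → ℂ) :
    contourOp A (fun z => c * f z) θ = c • contourOp A f θ := by
  simp only [contourOp_eq, mul_smul]
  rw [contourIntegral_smul, smul_comm]

theorem invOneAdd_eq (h : Admissible A ω γ α θ) :
    invOneAdd A = contourOp A (fun z => (1 + z)⁻¹) θ := by
  simp only [inv_one_add_eq, contourOp_const_mul, h.contourOp_inv_sub, neg_one_smul, invOneAdd]

theorem invOneAdd_pow_mul (h : Admissible A ω γ α θ) {f : ℂ → ℂ}
    (hf : SectorDecay (rays (-θ) θ) f) (n : ℕ) :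
    invOneAdd A ^ n * contourOp A f θ = contourOp A (fun z => f z * ((1 + z) ^ n)⁻¹) θ := by
  induction n generalizing f with
  | zero => simp
  | succ n ih =>
    have hg := sectorDecay_inv_one_add h.angle_lt_pi
    rw [pow_succ, mul_assoc, h.invOneAdd_eq, h.mul hg hf, ← h.invOneAdd_eq, ih (hg.mul hf)]
    congr 1
    ext z
    rw [pow_succ, mul_inv]
    ring

theorem commute_invOneAdd_pow (h : Admissible A ω γ α θ) {f : ℂ → ℂ}
    (hf : SectorDecay (rays (-θ) θ) f) (n : ℕ) :
    Commute (invOneAdd A ^ n) (contourOp A f θ) := by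
  refine Commute.pow_left ?_ n
  rw [h.invOneAdd_eq]
  exact h.commute (sectorDecay_inv_one_add h.angle_lt_pi) hf

omit [CompleteSpace X] in
theorem invOneAdd_pow_injective (h : Admissible A ω γ α θ) (n : ℕ) :
    Function.Injective (invOneAdd A ^ n) := by
  induction n with
  | zero => exact fun x y hxy => hxy
  | succ n ih =>
    intro x y hxy
    rw [pow_succ] at hxy
    exact resolventOp_injective h.neg_one_mem (neg_injective (ih hxy))

omit [CompleteSpace X] in
theorem contourOp_regPow (h : Admissible A ω γ α θ) :
    contourOp A (regPow α) ((ω + Real.pi) / 2) = contourOp A (regPow α) θ := by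
  have hπ := h.angle_lt_pi
  have hω := h.lt_angle
  exact (sectorDecay_regPow h.pow_pos (max_lt hπ (by linarith))).contourOp_eq_contourOp
    h.almostSectorial h.angle_nonneg h.neg_one_lt h.lt_zero (max_lt hπ (by linarith)).le
    (by linarith) (le_max_right θ ((ω + Real.pi) / 2)) hω (le_max_left _ _)

theorem contourOp_regPow_mul (h : Admissible A ω γ α θ) {t : ℂ}
    (ht : t ∈ openSector (Real.pi / 2 - α * θ)) :
    contourOp A (regPow α) θ * contourOp A (expFun α t) θ =
      invOneAdd A ^ regExponent α * contourOp A (powExpFun α t) θ := by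
  rw [h.mul (sectorDecay_regPow h.pow_pos h.angle_lt_pi) (h.decay_expFun ht),
    h.invOneAdd_pow_mul (h.decay_powExpFun ht)]
  congr 1
  ext z
  rw [regPow, powExpFun]
  ring

omit [CompleteSpace X] in
theorem mem_graph_iff (h : Admissible A ω γ α θ) {x y : X} :
    (x, y) ∈ (fracPower A ω α).graph ↔
      (invOneAdd A ^ regExponent α) y = contourOp A (regPow α) θ x := by
  rw [graph_fracPower h.neg_one_mem, ← h.contourOp_regPow]
  rfl

/-- The values of 𝒯_α(t) lie in D(A^α), and A^α𝒯_α(t) = (z^α e^{-tz^α})(A): after applying (1 + A)⁻ⁿ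
this is multiplicativity of the calculus. -/
theorem mem_graph (h : Admissible A ω γ α θ) {t : ℂ}
    (ht : t ∈ openSector (Real.pi / 2 - α * θ)) (x : X) :
    (contourOp A (expFun α t) θ x,
      contourOp A (powExpFun α t) θ x) ∈ (fracPower A ω α).graph := by
  rw [h.mem_graph_iff]
  exact (DFunLike.congr_fun (h.contourOp_regPow_mul ht) x).symm

/-- In other words A^α𝒯_α(t)x = 𝒯_α(t)A^αx on D(A^α). Both sides agree after applying the injective
operator (1 + A)⁻ⁿ, because functions of A commute. -/
theorem contourOp_fracPower (h : Admissible A ω γ α θ) {t : ℂ}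
    (ht : t ∈ openSector (Real.pi / 2 - α * θ)) {x y : X}
    (hxy : (x, y) ∈ (fracPower A ω α).graph) :
    contourOp A (powExpFun α t) θ x =
      contourOp A (expFun α t) θ y := by
  rw [h.mem_graph_iff] at hxy
  apply h.invOneAdd_pow_injective (regExponent α)
  have h1 := DFunLike.congr_fun (h.contourOp_regPow_mul ht) x
  have h2 := DFunLike.congr_fun
    (h.commute (sectorDecay_regPow h.pow_pos h.angle_lt_pi) (h.decay_expFun ht)).eq x
  have h3 := DFunLike.congr_fun (h.commute_invOneAdd_pow (h.decay_expFun ht) (regExponent α)).eq y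
  simp only [mul_apply_eq_comp] at h1 h2 h3
  rw [h3, hxy, ← h2, h1]

/-! ### Differentiability and growth -/

omit [CompleteSpace X] in
theorem exists_resolvent_bound (h : Admissible A ω γ α θ) : ∃ C : ℝ, 0 < C ∧
    ∀ a, (a = θ ∨ a = -θ) → ∀ r : ℝ, 0 < r → ‖resolventOp A (rayPoint a r)‖ ≤ C * r ^ γ := by
  obtain ⟨ν, hν, hν'⟩ := exists_between h.lt_angle
  have hν0 : 0 ≤ ν := h.angle_nonneg.trans hν.le
  obtain ⟨C, hC, hb⟩ := h.almostSectorial.resolvent_bound ν hν (hν'.trans h.angle_lt_pi)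
  refine ⟨C, hC, fun a ha r hr => ?_⟩
  have := hb (rayPoint a r) ?_
  · rwa [norm_rayPoint, abs_of_pos hr] at this
  · rcases ha with rfl | rfl
    · exact rays_subset_compl_closedSector hν0 hν' h.angle_lt_pi.le
        (rayPoint_mem_rays ⟨le_rfl, le_rfl⟩ hr)
    · exact rays_neg_subset_compl_closedSector hν0 hν' h.angle_lt_pi.le
        (rayPoint_mem_rays ⟨le_rfl, le_rfl⟩ hr)

omit [CompleteSpace X] in
theorem contourIntegrable (h : Admissible A ω γ α θ) {f : ℂ → ℂ}
    (hf : SectorDecay (rays (-θ) θ) f) : ∀ a, (a = θ ∨ a = -θ) →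
      IntegrableOn (rayIntegrand A f a) (Ioi 0) := by
  have := hf.contourIntegrable h.almostSectorial h.angle_nonneg h.neg_one_lt h.lt_zero
    h.angle_lt_pi.le h.lt_angle
  rintro a (rfl | rfl)
  exacts [this.1, this.2]

omit [CompleteSpace X] in
theorem abs_le_of_eq (h : Admissible A ω γ α θ) {a : ℝ} (ha : a = θ ∨ a = -θ) :
    a ∈ Icc (-θ) θ := by
  have := h.angle_nonneg.trans h.lt_angle.le
  rcases ha with rfl | rfl <;> constructor <;> linarith

omit [CompleteSpace X] in
theorem norm_rayIntegrand (f : ℂ → ℂ) (a r : ℝ) :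
    ‖rayIntegrand A f a r‖ = ‖f (rayPoint a r)‖ * ‖resolventOp A (rayPoint a r)‖ := by
  rw [rayIntegrand, norm_smul, norm_mul, Complex.norm_exp_ofReal_mul_I, mul_one]

omit [CompleteSpace X] in
theorem aestronglyMeasurable_rayIntegrand (h : Admissible A ω γ α θ) {f : ℂ → ℂ}
    (hf : ∀ z ∈ rays (-θ) θ, DifferentiableAt ℂ f z) {a : ℝ} (ha : a = θ ∨ a = -θ) :
    AEStronglyMeasurable (rayIntegrand A f a) (volume.restrict (Ioi 0)) := by
  obtain ⟨ν, hν, hν'⟩ := exists_between h.lt_angle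
  have hν0 : 0 ≤ ν := h.angle_nonneg.trans hν.le
  have hsub : rays a a ⊆ (closedSector ν)ᶜ := by
    rcases ha with rfl | rfl
    · exact rays_subset_compl_closedSector hν0 hν' h.angle_lt_pi.le
    · exact rays_neg_subset_compl_closedSector hν0 hν' h.angle_lt_pi.le
  have ha' := h.abs_le_of_eq ha
  rw [funext (rayIntegrand_eq A f a)]
  refine ((continuousOn_comp_rayPoint (F := fun z => f z • resolventOp A z) (fun z hz => ?_)
    (⟨le_rfl, le_rfl⟩ : a ∈ Icc a a)).aestronglyMeasurable measurableSet_Ioi).const_smul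
      (Complex.exp (a * Complex.I))
  exact (hf z (rays_mono ha'.1 ha'.2 hz)).smul (h.almostSectorial.differentiableAt h.angle_nonneg hν
    (hν'.trans h.angle_lt_pi) (hsub hz))

omit [CompleteSpace X] in
theorem hasDerivAt_rayIntegral (h : Admissible A ω γ α θ) {t : ℂ}
    (ht : t ∈ openSector (Real.pi / 2 - α * θ)) {a : ℝ} (ha : a = θ ∨ a = -θ) :
    HasDerivAt (fun s => ∫ r in Ioi (0 : ℝ), rayIntegrand A (expFun α s) a r)
      (-∫ r in Ioi (0 : ℝ), rayIntegrand A (powExpFun α t) a r) t := by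
  obtain ⟨c, hc, hb⟩ := exists_le_mul_cpow_re h.pow_pos h.angle_lt_pi ht
  obtain ⟨C, hC, hR⟩ := h.exists_resolvent_bound
  have hα := h.pow_pos
  have hslit : ∀ z ∈ rays (-θ) θ, z ∈ Complex.slitPlane := fun z hz =>
    mem_slitPlane_of_mem_rays h.angle_lt_pi hz
  rw [← integral_neg]
  have hdom := hasDerivAt_integral_of_dominated_loc_of_deriv_le (𝕜 := ℂ)
    -- For |s - t| < c/2 the perturbation (t - s)z^α costs at most half of the decay c|z|^α, so
    -- e^{-(c/2)r^α} serves uniformly in s. The majorant is integrable since α + γ > -1.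
    (μ := volume.restrict (Ioi (0 : ℝ))) (s := Metric.ball t (c / 2))
    (F := fun s => rayIntegrand A (expFun α s) a)
    (F' := fun s r => -rayIntegrand A (powExpFun α s) a r)
    (bound := fun r => C * (r ^ (α + γ) * Real.exp (-(c / 2) * r ^ α)))
    (Metric.ball_mem_nhds t (half_pos hc))
    (Eventually.of_forall fun s => h.aestronglyMeasurable_rayIntegrand
      (fun z hz => differentiableAt_expFun (hslit z hz)) ha)
    (h.contourIntegrable (h.decay_expFun ht) a ha)
    (h.aestronglyMeasurable_rayIntegrand (h.decay_powExpFun ht).diff ha).neg ?_ ?_ ?_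
  · exact hdom.2
  · filter_upwards [ae_restrict_mem measurableSet_Ioi] with r hr s hs
    have hr : 0 < r := hr
    have h1 := hb _ (rayPoint_mem_rays (h.abs_le_of_eq ha) hr)
    set z := rayPoint a r with hz
    have hzr : ‖z‖ = r := by rw [hz, norm_rayPoint, abs_of_pos hr]
    have h2 : c / 2 * r ^ α ≤ (s * z ^ (α : ℂ)).re := by
      have h3 : ‖(t - s) * z ^ (α : ℂ)‖ ≤ c / 2 * r ^ α := by
        rw [norm_mul, Complex.norm_cpow_real, hzr, ← dist_eq_norm, dist_comm]
        gcongr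
        exact (Metric.mem_ball.1 hs).le
      have h4 := (Complex.re_le_norm _).trans h3
      rw [sub_mul, Complex.sub_re] at h4
      rw [hzr] at h1
      linarith
    rw [norm_neg, norm_rayIntegrand, powExpFun, norm_mul, norm_expFun,
      Complex.norm_cpow_real, ← hz, hzr, Real.rpow_add hr]
    calc _ ≤ r ^ α * Real.exp (-(c / 2) * r ^ α) * (C * r ^ γ) := by
          gcongr
          · rw [neg_mul]
            exact neg_le_neg h2
          · exact hR a ha r hr
      _ = _ := by ring
  · exact (integrableOn_rpow_mul_exp_neg_mul_rpow (by linarith [h.neg_one_lt]) hα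
      (half_pos hc)).const_mul C
  · refine Eventually.of_forall fun r s _ => ?_
    have h1 : HasDerivAt (fun s => expFun α s (rayPoint a r))
        (-powExpFun α s (rayPoint a r)) s := by
      have := ((hasDerivAt_id s).neg.mul_const (rayPoint a r ^ (α : ℂ))).cexp
      refine this.congr_deriv ?_
      simp only [powExpFun, expFun, Pi.neg_apply, id_eq]
      ring
    have := (h1.mul_const (Complex.exp (a * Complex.I))).smul_const (resolventOp A (rayPoint a r))
    rwa [neg_mul, neg_smul] at this

omit [CompleteSpace X] in
theorem hasDerivAt_contourOp (h : Admissible A ω γ α θ) {t : ℂ}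
    (ht : t ∈ openSector (Real.pi / 2 - α * θ)) :
    HasDerivAt (fun s => contourOp A (expFun α s) θ)
      (-contourOp A (powExpFun α t) θ) t := by
  have := ((h.hasDerivAt_rayIntegral ht (Or.inr rfl)).sub
    (h.hasDerivAt_rayIntegral ht (Or.inl rfl))).const_smul (2 * Real.pi * Complex.I : ℂ)⁻¹
  refine this.congr_deriv ?_
  rw [contourOp, ← smul_neg]
  congr 1
  abel

omit [CompleteSpace X] in
theorem pos_angle (h : Admissible A ω γ α θ) : 0 < θ := h.angle_nonneg.trans_lt h.lt_angle

omit [CompleteSpace X] in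
theorem hasDerivAt (h : Admissible A ω γ α θ) {t : ℂ}
    (ht : t ∈ openSector (Real.pi / 2 - α * θ)) :
    HasDerivAt (fracSemigroup A ω α)
      (-contourOp A (powExpFun α t) θ) t := by
  refine (h.hasDerivAt_contourOp ht).congr_of_eventuallyEq ?_
  have hle : Real.pi / 2 - α * θ ≤ Real.pi := by
    have := mul_pos h.pow_pos h.pos_angle
    linarith [Real.pi_pos]
  filter_upwards [(isOpen_openSector hle).mem_nhds ht] with s hs using h.fracSemigroup_eq hs

-- For real t, Re(t z^α) ≥ c t|z|^α with the constant c belonging to t = 1. The integral of r^γ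
-- e^{-ct r^α} is a Gamma value times (ct)^(-(1+γ)/α), which is the source of the growth order.
omit [CompleteSpace X] in
theorem exists_growth_bound (h : Admissible A ω γ α θ) (hθ : α * θ < Real.pi / 2) :
    ∃ C : ℝ, 0 < C ∧ ∀ t : ℝ, 0 < t →
      ‖fracSemigroup A ω α (t : ℂ)‖ ≤ C * t ^ (-((1 + γ) / α)) := by
  obtain ⟨C, hC, hR⟩ := h.exists_resolvent_bound
  have hα := h.pow_pos
  have h1 : (1 : ℂ) ∈ openSector (Real.pi / 2 - α * θ) := by
    simpa using ofReal_mem_openSector (sub_pos.2 hθ) one_pos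
  obtain ⟨c, hc, hb⟩ := exists_le_mul_cpow_re hα h.angle_lt_pi h1
  have hG : 0 < Real.Gamma ((γ + 1) / α) :=
    Real.Gamma_pos_of_pos (div_pos (by linarith [h.neg_one_lt]) hα)
  set K := C * (c ^ (-(γ + 1) / α) * (1 / α) * Real.Gamma ((γ + 1) / α)) with hK
  have hK0 : 0 < K := by positivity
  refine ⟨(2 * Real.pi)⁻¹ * (K + K), by have := Real.pi_pos; positivity, fun t ht => ?_⟩
  have hray : ∀ a, (a = θ ∨ a = -θ) →
      ‖∫ r in Ioi (0 : ℝ), rayIntegrand A (expFun α t) a r‖ ≤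
        K * t ^ (-((1 + γ) / α)) := by
    intro a ha
    have hint := integrableOn_rpow_mul_exp_neg_mul_rpow (s := γ) h.neg_one_lt hα (mul_pos hc ht)
    refine (norm_integral_le_of_norm_le (hint.const_mul C) ?_).trans_eq ?_
    · filter_upwards [ae_restrict_mem measurableSet_Ioi] with r hr
      have hr : 0 < r := hr
      have h2 := hb _ (rayPoint_mem_rays (h.abs_le_of_eq ha) hr)
      rw [norm_rayPoint, abs_of_pos hr, one_mul] at h2
      rw [norm_rayIntegrand, norm_expFun, Complex.re_ofReal_mul]
      calc _ ≤ Real.exp (-(c * t) * r ^ α) * (C * r ^ γ) := by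
            gcongr
            · have := mul_le_mul_of_nonneg_left h2 ht.le
              linarith
            · exact hR a ha r hr
        _ = _ := by ring
    · rw [integral_const_mul, integral_rpow_mul_exp_neg_mul_rpow hα h.neg_one_lt (mul_pos hc ht),
        Real.mul_rpow hc.le ht.le, hK, show -((1 + γ) / α) = -(γ + 1) / α by ring]
      ring
  rw [h.fracSemigroup_eq (ofReal_mem_openSector (sub_pos.2 hθ) ht), contourOp, norm_smul]
  have hn : ‖(2 * Real.pi * Complex.I : ℂ)⁻¹‖ = (2 * Real.pi)⁻¹ := by
    simp [abs_of_pos Real.pi_pos]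
  rw [hn, mul_assoc, add_mul]
  gcongr
  exact (norm_sub_le _ _).trans (add_le_add (hray _ (Or.inr rfl)) (hray _ (Or.inl rfl)))

/-- Strong continuity at the origin of the regularized operators, along rays. -/
theorem tendsto_fracSemigroup_mul_resolventOp (h : Admissible A ω γ α θ) {s : ℂ}
    (hs : s ∈ openSector (Real.pi / 2 - α * θ)) :
    Tendsto (fun l : ℝ => fracSemigroup A ω α (l * s) * resolventOp A (-1)) (𝓝[>] 0)
      (𝓝 (resolventOp A (-1))) := by
  obtain ⟨c, hc, hb⟩ := exists_le_mul_cpow_re h.pow_pos h.angle_lt_pi hs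
  set q : ℂ → ℂ := fun z => (-1 - z)⁻¹ with hq
  have hqd : SectorDecay (rays (-θ) θ) q := sectorDecay_inv_neg_one_sub h.angle_lt_pi
  have heq : ∀ l : ℝ, 0 < l → fracSemigroup A ω α (l * s) * resolventOp A (-1) =
      contourOp A (fun z => expFun α (l * s) z * q z) θ := by
    intro l hl
    have hls := real_mul_mem_openSector hs hl
    rw [h.fracSemigroup_eq hls, ← h.contourOp_inv_sub, h.mul (h.decay_expFun hls) hqd]
  have hray : ∀ a, (a = θ ∨ a = -θ) → Tendsto (fun l : ℝ => ∫ r in Ioi (0 : ℝ),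
      rayIntegrand A (fun z => expFun α (l * s) z * q z) a r) (𝓝[>] 0)
      (𝓝 (∫ r in Ioi (0 : ℝ), rayIntegrand A q a r)) := by
    intro a ha
    -- Since Re(s z^α) ≥ 0, |e^{-lsz^α}| ≤ 1, and the integrand for (-1 - z)⁻¹ alone is a majorant.
    refine tendsto_integral_filter_of_dominated_convergence (fun r => ‖rayIntegrand A q a r‖)
      ?_ ?_ (h.contourIntegrable hqd a ha).norm ?_
    · filter_upwards [self_mem_nhdsWithin] with l hl
      exact h.aestronglyMeasurable_rayIntegrand
        ((h.decay_expFun (real_mul_mem_openSector hs hl)).mul hqd).diff ha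
    · filter_upwards [self_mem_nhdsWithin] with l hl
      filter_upwards [ae_restrict_mem measurableSet_Ioi] with r hr
      have h2 := hb _ (rayPoint_mem_rays (h.abs_le_of_eq ha) hr)
      rw [norm_rayIntegrand, norm_rayIntegrand, norm_mul, norm_expFun, mul_assoc (l : ℂ),
        Complex.re_ofReal_mul]
      gcongr
      refine mul_le_of_le_one_left (norm_nonneg _) (Real.exp_le_one_iff.2 ?_)
      have h3 : 0 ≤ (s * rayPoint a r ^ (α : ℂ)).re := le_trans (by positivity) h2
      have := mul_nonneg (le_of_lt hl) h3
      linarith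
    · refine Eventually.of_forall fun r => ?_
      have h1 : Tendsto (fun l : ℝ => expFun α (l * s) (rayPoint a r)) (𝓝[>] 0)
          (𝓝 1) := by
        have : Continuous fun l : ℝ => expFun α (l * s) (rayPoint a r) := by
          unfold expFun
          fun_prop
        have h0 := this.tendsto 0
        simp only [expFun, Complex.ofReal_zero, zero_mul, neg_zero,
          Complex.exp_zero] at h0
        exact h0.mono_left nhdsWithin_le_nhds
      have := ((h1.mul_const (q (rayPoint a r))).mul_const
        (Complex.exp (a * Complex.I))).smul_const (resolventOp A (rayPoint a r))
      simpa only [rayIntegrand, one_mul] using this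
  have hlim := ((hray _ (Or.inr rfl)).sub (hray _ (Or.inl rfl))).const_smul
    (2 * Real.pi * Complex.I : ℂ)⁻¹
  refine Tendsto.congr' ?_ (by rwa [← h.contourOp_inv_sub])
  filter_upwards [self_mem_nhdsWithin] with l hl
  exact (heq l hl).symm

theorem commute_resolventOp (h : Admissible A ω γ α θ) {t : ℂ}
    (ht : t ∈ openSector (Real.pi / 2 - α * θ)) :
    Commute (fracSemigroup A ω α t) (resolventOp A (-1)) := by
  rw [h.fracSemigroup_eq ht, ← h.contourOp_inv_sub]
  exact h.commute (h.decay_expFun ht) (sectorDecay_inv_neg_one_sub h.angle_lt_pi)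

end Admissible

end

section

/-! ### The semigroup property -/

variable {X : Type*} [NormedAddCommGroup X] [NormedSpace ℂ X] {A : X →ₗ.[ℂ] X} {ω γ α θ : ℝ}

/-- Taking x = |arg t| gives one path that serves all points with arguments near arg t. The
requirement θ ≤ π/2, needed for multiplicativity, can be met because ω < π/2. -/
theorem exists_admissible (hA : IsAlmostSectorial A ω γ) (hω : 0 ≤ ω) (hω' : ω < Real.pi / 2)
    (hγ : -1 < γ) (hγ' : γ < 0) (hα : 0 < α) {x : ℝ} (hx : x < Real.pi / 2 - α * ω) :
    ∃ θ, Admissible A ω γ α θ ∧ x < Real.pi / 2 - α * θ := by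
  have h1 : ω < (Real.pi / 2 - x) / α := by
    rw [lt_div_iff₀ hα]
    linarith
  obtain ⟨θ, h2, h3⟩ := exists_between (lt_min hω' h1)
  rw [lt_min_iff, lt_div_iff₀ hα] at h3
  exact ⟨θ, ⟨hA, hω, hγ, hγ', hα, h2, h3.1.le⟩, by linarith [h3.2]⟩

namespace Admissible

variable [CompleteSpace X]

omit [CompleteSpace X] in
theorem mul_angle_nonneg (h : Admissible A ω γ α θ) : 0 ≤ α * θ :=
  mul_nonneg h.pow_pos.le h.pos_angle.le

theorem mul_angle_lt {t : ℂ} (ht : t ∈ openSector (Real.pi / 2 - α * θ)) :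
    α * θ < Real.pi / 2 := by
  linarith [abs_nonneg t.arg, ht.2]

theorem powExpFun_mul_expFun (h : Admissible A ω γ α θ) {t s : ℂ}
    (ht : t ∈ openSector (Real.pi / 2 - α * θ)) (hs : s ∈ openSector (Real.pi / 2 - α * θ)) :
    contourOp A (powExpFun α t) θ * contourOp A (expFun α s) θ =
      contourOp A (expFun α t) θ * contourOp A (powExpFun α s) θ := by
  ext x
  exact h.contourOp_fracPower ht (h.mem_graph hs x)

omit [CompleteSpace X] in
theorem resolventOp_mul_injective (h : Admissible A ω γ α θ) {U V : X →L[ℂ] X}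
    (hUV : resolventOp A (-1) * U = resolventOp A (-1) * V) : U = V := by
  ext x
  exact resolventOp_injective h.neg_one_mem (DFunLike.congr_fun hUV x)

/-- The function l ↦ 𝒯_α(t + s - ls)𝒯_α(ls) has derivative 0 on (0,1], since A^α𝒯_α can be moved
across the product. It equals 𝒯_α(t)𝒯_α(s) at l = 1; as l → 0 it tends to 𝒯_α(t + s) once multiplied
by the resolvent, which is cancelled afterwards. -/
theorem fracSemigroup_add (h : Admissible A ω γ α θ) {t s : ℂ}
    (ht : t ∈ openSector (Real.pi / 2 - α * θ)) (hs : s ∈ openSector (Real.pi / 2 - α * θ)) :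
    fracSemigroup A ω α (t + s) = fracSemigroup A ω α t * fracSemigroup A ω α s := by
  have hδ := mul_angle_lt ht
  have hts := add_mem_openSector h.mul_angle_nonneg hδ ht hs
  set G : ℝ → X →L[ℂ] X := fun l =>
    fracSemigroup A ω α (t + s - l * s) * fracSemigroup A ω α (l * s) with hG
  have hmem : ∀ l : ℝ, l ≤ 1 → t + s - l * s ∈ openSector (Real.pi / 2 - α * θ) := by
    intro l hl
    rcases hl.eq_or_lt with rfl | hl
    · simpa using ht
    · have := add_mem_openSector h.mul_angle_nonneg hδ ht (real_mul_mem_openSector hs (sub_pos.2 hl))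
      convert this using 1
      push_cast
      ring
  have hderiv : ∀ l : ℝ, 0 < l → l ≤ 1 → HasDerivAt G 0 l := by
    intro l hl hl1
    have h1 : HasDerivAt (fun z : ℂ => t + s - z * s) (-s) (l : ℂ) := by
      simpa using ((hasDerivAt_id (l : ℂ)).mul_const s).const_sub (t + s)
    have h2 : HasDerivAt (fun z : ℂ => z * s) s (l : ℂ) := by
      simpa using (hasDerivAt_id (l : ℂ)).mul_const s
    have hl2 := real_mul_mem_openSector hs hl
    have h3 := HasDerivAt.scomp (l : ℂ) (h.hasDerivAt (hmem l hl1)) h1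
    have h4 := HasDerivAt.scomp (l : ℂ) (h.hasDerivAt hl2) h2
    have h5 := (h3.mul h4).scomp l Complex.ofRealCLM.hasDerivAt
    refine h5.congr_deriv ?_
    simp only [Function.comp_apply]
    rw [h.fracSemigroup_eq (hmem l hl1), h.fracSemigroup_eq hl2, neg_smul, smul_neg, neg_neg,
      smul_neg, mul_neg, smul_mul_assoc, mul_smul_comm, h.powExpFun_mul_expFun (hmem l hl1) hl2,
      add_neg_cancel, smul_zero]
  have hconst : ∀ l : ℝ, 0 < l → l ≤ 1 → G l = fracSemigroup A ω α t * fracSemigroup A ω α s := by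
    intro l hl hl1
    have := constant_of_has_deriv_right_zero (f := G) (a := l) (b := 1)
      (fun x hx => (hderiv x (hl.trans_le hx.1) hx.2).continuousAt.continuousWithinAt)
      (fun x hx => (hderiv x (hl.trans_le hx.1) hx.2.le).hasDerivWithinAt) 1 ⟨hl1, le_rfl⟩
    rw [← this, hG]
    simp
  have hlim : Tendsto (fun l : ℝ => fracSemigroup A ω α (t + s - l * s) *
      (fracSemigroup A ω α (l * s) * resolventOp A (-1))) (𝓝[>] 0)
      (𝓝 (fracSemigroup A ω α (t + s) * resolventOp A (-1))) := by
    refine Tendsto.mul ?_ (h.tendsto_fracSemigroup_mul_resolventOp hs)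
    have h1 : Tendsto (fun l : ℝ => t + s - l * s) (𝓝[>] 0) (𝓝 (t + s)) := by
      have : Continuous fun l : ℝ => t + s - l * s := by fun_prop
      have h0 := this.tendsto 0
      simp only [Complex.ofReal_zero, zero_mul, sub_zero] at h0
      exact h0.mono_left nhdsWithin_le_nhds
    exact (h.hasDerivAt hts).continuousAt.tendsto.comp h1
  have hlim' : Tendsto (fun l : ℝ => fracSemigroup A ω α (t + s - l * s) *
      (fracSemigroup A ω α (l * s) * resolventOp A (-1))) (𝓝[>] 0)
      (𝓝 (fracSemigroup A ω α t * fracSemigroup A ω α s * resolventOp A (-1))) := by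
    refine tendsto_const_nhds.congr' ?_
    filter_upwards [Ioc_mem_nhdsGT (zero_lt_one' ℝ)] with l hl
    rw [← mul_assoc, ← hconst l hl.1 hl.2]
  have heq := tendsto_nhds_unique hlim hlim'
  refine h.resolventOp_mul_injective ?_
  rw [← (h.commute_resolventOp hts).eq, heq,
    ((h.commute_resolventOp ht).mul_left (h.commute_resolventOp hs)).eq]

theorem tendsto_resolventOp_fracSemigroup (h : Admissible A ω γ α θ) {s : ℂ}
    (hs : s ∈ openSector (Real.pi / 2 - α * θ)) :
    Tendsto (fun l : ℝ => resolventOp A (-1) * fracSemigroup A ω α (l * s)) (𝓝[>] 0)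
      (𝓝 (resolventOp A (-1))) := by
  refine (h.tendsto_fracSemigroup_mul_resolventOp hs).congr' ?_
  filter_upwards [self_mem_nhdsWithin] with l hl
  exact (h.commute_resolventOp (real_mul_mem_openSector hs hl)).eq

theorem analyticOnNhd (h : Admissible A ω γ α θ) :
    AnalyticOnNhd ℂ (fracSemigroup A ω α) (openSector (Real.pi / 2 - α * θ)) := by
  refine DifferentiableOn.analyticOnNhd
    (fun t ht => (h.hasDerivAt ht).differentiableAt.differentiableWithinAt) (isOpen_openSector ?_)
  linarith [h.mul_angle_nonneg, Real.pi_pos]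

/-- By the semigroup law 𝒯_α(z)x = 𝒯_α(z - t)𝒯_α(t)x vanishes for z near 2t, hence on the whole
connected sector by the identity theorem. Letting z → 0 along the ray through t, after applying the
resolvent, gives x = 0. -/
theorem eq_zero_of_fracSemigroup_eq_zero (h : Admissible A ω γ α θ) {t : ℂ}
    (ht : t ∈ openSector (Real.pi / 2 - α * θ)) {x : X} (hx : fracSemigroup A ω α t x = 0) :
    x = 0 := by
  have hδ := mul_angle_lt ht
  have hop : IsOpen (openSector (Real.pi / 2 - α * θ)) :=
    isOpen_openSector (by linarith [h.mul_angle_nonneg, Real.pi_pos])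
  have htt := add_mem_openSector h.mul_angle_nonneg hδ ht ht
  have han : AnalyticOnNhd ℂ (fun z => fracSemigroup A ω α z x)
      (openSector (Real.pi / 2 - α * θ)) := fun z hz =>
    (ContinuousLinearMap.apply ℂ X x).analyticAt _ |>.comp (h.analyticOnNhd z hz)
  have hev : (fun z => fracSemigroup A ω α z x) =ᶠ[𝓝 (t + t)] 0 := by
    have h1 : Tendsto (fun z : ℂ => z - t) (𝓝 (t + t)) (𝓝 t) := by
      have : Continuous fun z : ℂ => z - t := by fun_prop
      simpa using this.tendsto (t + t)
    filter_upwards [h1.eventually (hop.mem_nhds ht)] with z hz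
    have := h.fracSemigroup_add hz ht
    rw [sub_add_cancel] at this
    rw [this]
    simp [hx]
  have hzero := han.eqOn_zero_of_preconnected_of_eventuallyEq_zero
    (convex_openSector h.mul_angle_nonneg hδ).isPreconnected htt hev
  have hlim := (ContinuousLinearMap.apply ℂ X x).continuous.tendsto _ |>.comp
    (h.tendsto_resolventOp_fracSemigroup ht)
  have hlim' : Tendsto (fun l : ℝ => (resolventOp A (-1) * fracSemigroup A ω α (l * t)) x)
      (𝓝[>] 0) (𝓝 0) := by
    refine tendsto_const_nhds.congr' ?_
    filter_upwards [self_mem_nhdsWithin] with l hl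
    have := hzero (real_mul_mem_openSector ht hl)
    simp only [Pi.zero_apply] at this
    simp [this]
  have := tendsto_nhds_unique hlim hlim'
  exact resolventOp_injective h.neg_one_mem (by simpa using this)

end Admissible

end

section

/-! ### Primitives of continuous positive functions -/

section Primitive

variable {φ : ℝ → ℝ}

theorem intervalIntegrable_of_continuousOn_Ici (hφ : ContinuousOn φ (Ici 0)) {a b : ℝ}
    (ha : 0 ≤ a) (hb : 0 ≤ b) : IntervalIntegrable φ volume a b :=
  (hφ.mono fun _ hx => (le_inf ha hb).trans hx.1).intervalIntegrable

theorem hasDerivAt_primitive (hφ : ContinuousOn φ (Ici 0)) {t : ℝ} (ht : 0 < t) :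
    HasDerivAt (fun t => ∫ s in (0 : ℝ)..t, φ s) (φ t) t :=
  intervalIntegral.integral_hasDerivAt_right
    (intervalIntegrable_of_continuousOn_Ici hφ le_rfl ht.le)
    ((hφ.mono Ioi_subset_Ici_self).stronglyMeasurableAtFilter isOpen_Ioi t ht)
    (hφ.continuousAt (Ici_mem_nhds ht))

theorem primitive_lt_primitive (hφ : ContinuousOn φ (Ici 0)) (hφ_pos : ∀ t, 0 < t → 0 < φ t)
    {s t : ℝ} (hs : 0 ≤ s) (hst : s < t) :
    ∫ x in (0 : ℝ)..s, φ x < ∫ x in (0 : ℝ)..t, φ x := by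
  have h := intervalIntegral.intervalIntegral_pos_of_pos_on
    (intervalIntegrable_of_continuousOn_Ici hφ hs (hs.trans hst.le))
    (fun x hx => hφ_pos x (hs.trans_lt hx.1)) hst
  rw [← intervalIntegral.integral_add_adjacent_intervals
    (intervalIntegrable_of_continuousOn_Ici hφ le_rfl hs)
    (intervalIntegrable_of_continuousOn_Ici hφ hs (hs.trans hst.le))]
  linarith

theorem primitive_pos (hφ : ContinuousOn φ (Ici 0)) (hφ_pos : ∀ t, 0 < t → 0 < φ t)
    {t : ℝ} (ht : 0 < t) : 0 < ∫ x in (0 : ℝ)..t, φ x := by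
  simpa using primitive_lt_primitive hφ hφ_pos le_rfl ht

theorem continuousOn_primitive_Icc (hφ : ContinuousOn φ (Ici 0)) {b : ℝ} (hb : 0 ≤ b) :
    ContinuousOn (fun t => ∫ s in (0 : ℝ)..t, φ s) (Icc 0 b) := by
  have := intervalIntegral.continuousOn_primitive_interval (μ := volume) (f := φ) (a := 0) (b := b)
  rw [uIcc_of_le hb] at this
  exact this ((hφ.mono fun _ hx => hx.1).integrableOn_Icc)

/-- Equality of filters, not merely convergence, is needed to recover the limit of 𝒯_α(t)u₀ from
that of 𝒯_α(Φ(t))u₀; the reverse inclusion is the intermediate value theorem. -/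
theorem map_primitive_nhdsGT (hφ : ContinuousOn φ (Ici 0)) (hφ_pos : ∀ t, 0 < t → 0 < φ t) :
    map (fun t => ∫ s in (0 : ℝ)..t, φ s) (𝓝[>] 0) = 𝓝[>] 0 := by
  apply le_antisymm
  · refine tendsto_nhdsWithin_iff.2 ⟨?_, ?_⟩
    · have h := (continuousOn_primitive_Icc hφ zero_le_one) 0 ⟨le_rfl, zero_le_one⟩
      rw [ContinuousWithinAt, intervalIntegral.integral_same] at h
      exact h.mono_left (nhdsWithin_le_of_mem (Icc_mem_nhdsGT zero_lt_one))
    · filter_upwards [self_mem_nhdsWithin] with t ht using primitive_pos hφ hφ_pos ht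
  · intro U hU
    obtain ⟨ε, hε, hεU⟩ := (mem_nhdsGT_iff_exists_Ioo_subset).1 (mem_map.1 hU)
    refine mem_of_superset (Ioo_mem_nhdsGT (primitive_pos hφ hφ_pos hε)) fun x hx => ?_
    have hε' : (0 : ℝ) ≤ ε := le_of_lt hε
    have h := intermediate_value_Ioo hε' (continuousOn_primitive_Icc hφ hε')
    rw [intervalIntegral.integral_same] at h
    obtain ⟨t, ht, rfl⟩ := h hx
    exact hεU ht

theorem contDiffOn_primitive (hφ : ContinuousOn φ (Ici 0)) (T : ℝ) :
    ContDiffOn ℝ 1 (fun t => ∫ s in (0 : ℝ)..t, φ s) (Ioo 0 T) := by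
  have hd := fun t (ht : t ∈ Ioo 0 T) => hasDerivAt_primitive hφ ht.1
  rw [show (1 : WithTop ℕ∞) = 0 + 1 by simp, contDiffOn_succ_iff_deriv_of_isOpen isOpen_Ioo]
  refine ⟨fun t ht => (hd t ht).differentiableAt.differentiableWithinAt, by simp, ?_⟩
  rw [contDiffOn_zero]
  exact (hφ.mono fun t ht => (le_of_lt ht.1 : 0 ≤ t)).congr fun t ht => (hd t ht).deriv

end Primitive

/-! ### The Cauchy problem -/

namespace Admissible

variable {X : Type*} [NormedAddCommGroup X] [NormedSpace ℂ X] {A : X →ₗ.[ℂ] X} {ω γ α θ : ℝ}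

theorem tendsto_clm_apply {ι : Type*} {l : Filter ι} {U : ι → X →L[ℂ] X} {x : ι → X}
    {V : X →L[ℂ] X} {y : X} (hU : Tendsto U l (𝓝 V)) (hx : Tendsto x l (𝓝 y)) :
    Tendsto (fun i => U i (x i)) l (𝓝 (V y)) :=
  (isBoundedBilinearMap_apply.continuous.tendsto (V, y)).comp (hU.prodMk_nhds hx)

theorem ofReal_mem (hδ : α * θ < Real.pi / 2) {r : ℝ} (hr : 0 < r) :
    (r : ℂ) ∈ openSector (Real.pi / 2 - α * θ) :=
  ofReal_mem_openSector (sub_pos.2 hδ) hr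

variable {φ : ℝ → ℝ} {T : ℝ}

theorem hasDerivAt_comp_ofReal (h : Admissible A ω γ α θ) (hδ : α * θ < Real.pi / 2)
    {f : ℝ → ℝ} {f' t : ℝ} (hf : HasDerivAt f f' t) (ht : 0 < f t) :
    HasDerivAt (fun s => fracSemigroup A ω α (f s))
      (-((f' : ℂ) • contourOp A (powExpFun α (f t)) θ)) t := by
  have := (h.hasDerivAt (ofReal_mem hδ ht)).scomp t hf.ofReal_comp
  rwa [smul_neg] at this

variable [CompleteSpace X]

theorem tendsto_resolventOp_ofReal (h : Admissible A ω γ α θ) (hδ : α * θ < Real.pi / 2) :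
    Tendsto (fun r : ℝ => resolventOp A (-1) * fracSemigroup A ω α r) (𝓝[>] 0)
      (𝓝 (resolventOp A (-1))) := by
  have h1 : (1 : ℂ) ∈ openSector (Real.pi / 2 - α * θ) := by
    simpa using ofReal_mem hδ one_pos
  simpa using h.tendsto_resolventOp_fracSemigroup h1

theorem isClassicalSolution (h : Admissible A ω γ α θ) (hδ : α * θ < Real.pi / 2)
    (hφ : ContinuousOn φ (Ici 0)) (hφ_pos : ∀ t, 0 < t → 0 < φ t) {u₀ : X} {u : ℝ → X}
    (hu : ∀ t ∈ Ioo 0 T, u t = fracSemigroup A ω α ((∫ s in (0 : ℝ)..t, φ s : ℝ) : ℂ) u₀) :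
    IsClassicalSolution (fracPower A ω α) φ T u := by
  refine ⟨?_, fun t ht => ?_⟩
  · refine ContDiffOn.congr ?_ hu
    have h1 : ContDiffOn ℝ 1 (fun z => fracSemigroup A ω α z u₀)
        (openSector (Real.pi / 2 - α * θ)) := by
      refine ContDiffOn.restrict_scalars ℝ (𝕜' := ℂ) ?_
      exact (ContinuousLinearMap.apply ℂ X u₀).contDiff.comp_contDiffOn
        h.analyticOnNhd.contDiffOn_of_completeSpace
    exact h1.comp (Complex.ofRealCLM.contDiff.comp_contDiffOn (contDiffOn_primitive hφ T))
      fun t ht => ofReal_mem hδ (primitive_pos hφ hφ_pos ht.1)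
  · have hpos := primitive_pos hφ hφ_pos ht.1
    have hmem := h.mem_graph (ofReal_mem hδ hpos) u₀
    rw [← h.fracSemigroup_eq (ofReal_mem hδ hpos), ← hu t ht, LinearPMap.mem_graph_iff] at hmem
    obtain ⟨y, hy, hy'⟩ := hmem
    have hdom : u t ∈ (fracPower A ω α).domain := by
      have := y.2
      rwa [hy] at this
    have hyeq : y = ⟨u t, hdom⟩ := Subtype.ext hy
    refine ⟨hdom, ?_⟩
    rw [← hyeq, hy']
    have hd := ((ContinuousLinearMap.apply ℂ X u₀).restrictScalars ℝ).hasFDerivAt.comp_hasDerivAt t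
      (h.hasDerivAt_comp_ofReal hδ (hasDerivAt_primitive hφ ht.1) hpos)
    refine HasDerivAt.congr_of_eventuallyEq (hd.congr_deriv ?_) ?_
    · simp
    · filter_upwards [isOpen_Ioo.mem_nhds ht] with s hs using hu s hs

theorem hasInitialValue (h : Admissible A ω γ α θ) (hδ : α * θ < Real.pi / 2) (hT : 0 < T)
    (hφ : ContinuousOn φ (Ici 0)) (hφ_pos : ∀ t, 0 < t → 0 < φ t) {u₀ : X} {u : ℝ → X}
    (hu : ∀ t ∈ Ioo 0 T, u t = fracSemigroup A ω α ((∫ s in (0 : ℝ)..t, φ s : ℝ) : ℂ) u₀) :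
    HasInitialValue A u u₀ := by
  intro z hz
  have h1 : Tendsto (fun t => resolventOp A (-1) (u t)) (𝓝[>] 0) (𝓝 (resolventOp A (-1) u₀)) := by
    have := ((ContinuousLinearMap.apply ℂ X u₀).continuous.tendsto _).comp
      ((h.tendsto_resolventOp_ofReal hδ).comp (map_primitive_nhdsGT hφ hφ_pos).le)
    refine this.congr' ?_
    filter_upwards [Ioo_mem_nhdsGT hT] with t ht
    rw [hu t ht]
    rfl
  -- The resolvent identity factors every R(z) through R(-1), so convergence for -1 suffices.
  have h2 : ∀ x, resolventOp A z x = resolventOp A (-1) x +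
      (-1 - z) • resolventOp A z (resolventOp A (-1) x) := fun x => by
    rw [← sub_eq_iff_eq_add']
    exact DFunLike.congr_fun (resolvent_identity hz h.neg_one_mem) x
  rw [h2 u₀]
  simp only [h2 (u _)]
  exact h1.add ((((resolventOp A z).continuous.tendsto _).comp h1).const_smul _)

/-- The function G(s) = 𝒯_α(Φ(t) - Φ(s))u(s) has derivative 0 on (0,t), the two terms cancelling
because 𝒯_α commutes with A^α on D(A^α). Its limits as s → 0 and s → t, taken after applying R, are
R𝒯_α(Φ(t))u₀ and Ru(t). -/
theorem eq_of_isClassicalSolution (h : Admissible A ω γ α θ) (hδ : α * θ < Real.pi / 2)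
    (hφ : ContinuousOn φ (Ici 0)) (hφ_pos : ∀ t, 0 < t → 0 < φ t) {u₀ : X} {u : ℝ → X}
    (hu : IsClassicalSolution (fracPower A ω α) φ T u) (hu₀ : HasInitialValue A u u₀)
    {t : ℝ} (ht : t ∈ Ioo 0 T) :
    u t = fracSemigroup A ω α ((∫ s in (0 : ℝ)..t, φ s : ℝ) : ℂ) u₀ := by
  set Φ : ℝ → ℝ := fun t => ∫ s in (0 : ℝ)..t, φ s with hΦ
  set R := resolventOp A (-1) with hR
  set G : ℝ → X := fun s => fracSemigroup A ω α ((Φ t - Φ s : ℝ) : ℂ) (u s) with hG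
  have hpos : ∀ s ∈ Ioo 0 t, 0 < Φ t - Φ s := fun s hs =>
    sub_pos.2 (primitive_lt_primitive hφ hφ_pos hs.1.le hs.2)
  have hderiv : ∀ s ∈ Ioo 0 t, HasDerivAt G 0 s := by
    intro s hs
    obtain ⟨hdom, hus⟩ := hu.2 s ⟨hs.1, hs.2.trans ht.2⟩
    have h1 := h.hasDerivAt_comp_ofReal hδ ((hasDerivAt_primitive hφ hs.1).const_sub (Φ t))
      (hpos s hs)
    have h2 := ((ContinuousLinearMap.restrictScalarsL ℂ X X ℝ ℝ).hasFDerivAt.comp_hasDerivAt s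
      h1).clm_apply hus
    refine h2.congr_deriv ?_
    have h3 := h.contourOp_fracPower (ofReal_mem hδ (hpos s hs))
      (LinearPMap.mem_graph (fracPower A ω α) ⟨u s, hdom⟩)
    change (-(((-φ s : ℝ) : ℂ) • contourOp A (powExpFun α ((Φ t - Φ s : ℝ) : ℂ)) θ)) (u s) +
      fracSemigroup A ω α ((Φ t - Φ s : ℝ) : ℂ) (-((φ s : ℂ) • fracPower A ω α ⟨u s, hdom⟩)) = 0
    rw [map_neg, map_smul, h.fracSemigroup_eq (ofReal_mem hδ (hpos s hs)), ← h3]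
    simp
  have hconst : ∀ s ∈ Ioo 0 t, G s = G (t / 2) := fun s hs =>
    isOpen_Ioo.is_const_of_deriv_eq_zero isPreconnected_Ioo
      (fun x hx => (hderiv x hx).differentiableAt.differentiableWithinAt)
      (fun x hx => (hderiv x hx).deriv) hs ⟨half_pos ht.1, half_lt_self ht.1⟩
  have hΦ0 : Tendsto Φ (𝓝[>] 0) (𝓝 0) :=
    (map_primitive_nhdsGT hφ hφ_pos).le.trans nhdsWithin_le_nhds
  -- Near s = 0 the semigroup argument stays away from 0, and R is moved onto u(s), which is all
  -- that the initial condition controls.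
  have hleft : Tendsto (fun s => R (G s)) (𝓝[>] 0)
      (𝓝 (fracSemigroup A ω α (Φ t : ℂ) (R u₀))) := by
    have h1 : Tendsto (fun s => fracSemigroup A ω α ((Φ t - Φ s : ℝ) : ℂ)) (𝓝[>] 0)
        (𝓝 (fracSemigroup A ω α (Φ t : ℂ))) := by
      refine (h.hasDerivAt (ofReal_mem hδ
        (primitive_pos hφ hφ_pos ht.1))).continuousAt.tendsto.comp ?_
      have := (Complex.continuous_ofReal.tendsto _).comp (hΦ0.const_sub (Φ t))
      rwa [sub_zero] at this
    refine (tendsto_clm_apply h1 (hu₀ (-1) h.neg_one_mem)).congr' ?_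
    filter_upwards [Ioo_mem_nhdsGT ht.1] with s hs
    exact DFunLike.congr_fun (h.commute_resolventOp (ofReal_mem hδ (hpos s hs))).eq (u s)
  -- Near s = t the roles are exchanged: u is continuous in norm, and R tames the semigroup at
  -- argument 0.
  have hright : Tendsto (fun s => R (G s)) (𝓝[<] t) (𝓝 (R (u t))) := by
    have h1 : Tendsto (fun s => Φ t - Φ s) (𝓝[<] t) (𝓝[>] 0) := by
      refine tendsto_nhdsWithin_iff.2 ⟨?_, ?_⟩
      · have := ((hasDerivAt_primitive hφ ht.1).continuousAt.tendsto.const_sub (Φ t))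
        rw [sub_self] at this
        exact this.mono_left nhdsWithin_le_nhds
      · filter_upwards [Ioo_mem_nhdsLT ht.1] with s hs using hpos s hs
    obtain ⟨_, hut⟩ := hu.2 t ht
    exact tendsto_clm_apply (U := fun s => R * fracSemigroup A ω α ((Φ t - Φ s : ℝ) : ℂ))
      ((h.tendsto_resolventOp_ofReal hδ).comp h1) (hut.continuousAt.tendsto.mono_left nhdsWithin_le_nhds)
  have e1 : R (G (t / 2)) = fracSemigroup A ω α (Φ t : ℂ) (R u₀) := by
    refine tendsto_nhds_unique (tendsto_const_nhds.congr' ?_) hleft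
    filter_upwards [Ioo_mem_nhdsGT ht.1] with s hs
    rw [hconst s hs]
  have e2 : R (G (t / 2)) = R (u t) := by
    refine tendsto_nhds_unique (tendsto_const_nhds.congr' ?_) hright
    filter_upwards [Ioo_mem_nhdsLT ht.1] with s hs
    rw [hconst s hs]
  apply resolventOp_injective h.neg_one_mem
  rw [← hR, ← e2, e1]
  exact DFunLike.congr_fun
    (h.commute_resolventOp (ofReal_mem hδ (primitive_pos hφ hφ_pos ht.1))).eq u₀

theorem isSolutionOperator (h : Admissible A ω γ α θ) (hδ : α * θ < Real.pi / 2) (hT : 0 < T)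
    (hφ : ContinuousOn φ (Ici 0)) (hφ_pos : ∀ t, 0 < t → 0 < φ t) :
    IsSolutionOperator A ω α φ T
      (fun t => fracSemigroup A ω α ((∫ s in (0 : ℝ)..t, φ s : ℝ) : ℂ)) := fun _ _ =>
  ⟨fun hu _ ht => h.eq_of_isClassicalSolution hδ hφ hφ_pos hu.1 hu.2 ht,
    fun hu => ⟨h.isClassicalSolution hδ hφ hφ_pos hu, h.hasInitialValue hδ hT hφ hφ_pos hu⟩⟩

omit [CompleteSpace X] in
theorem hasStrongInitialValue_iff (hT : 0 < T)
    (hφ : ContinuousOn φ (Ici 0)) (hφ_pos : ∀ t, 0 < t → 0 < φ t) {u₀ : X} {u : ℝ → X}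
    (hu : ∀ t ∈ Ioo 0 T, u t = fracSemigroup A ω α ((∫ s in (0 : ℝ)..t, φ s : ℝ) : ℂ) u₀) :
    HasStrongInitialValue u u₀ ↔ u₀ ∈ continuitySet (fracSemigroup A ω α) := by
  have h1 : u =ᶠ[𝓝[>] 0] (fun t : ℝ => fracSemigroup A ω α (t : ℂ) u₀) ∘
      fun t => ∫ s in (0 : ℝ)..t, φ s := by
    filter_upwards [Ioo_mem_nhdsGT hT] with t ht using hu t ht
  rw [HasStrongInitialValue, tendsto_congr' h1, ← tendsto_map'_iff, map_primitive_nhdsGT hφ hφ_pos]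
  rfl

omit [CompleteSpace X] in
theorem _root_.AlmostSectorial.HasStrongInitialValue.hasInitialValue {u : ℝ → X} {u₀ : X}
    (hu : HasStrongInitialValue u u₀) : HasInitialValue A u u₀ := fun z _ =>
  ((resolventOp A z).continuous.tendsto u₀).comp hu

end Admissible

end

end AlmostSectorial

end

/-! ### Assembly of the theorem -/

open AlmostSectorial in
theorem mainTheorem1 {X : Type*} [NormedAddCommGroup X] [NormedSpace ℂ X] [CompleteSpace X]
    (A : X →ₗ.[ℂ] X) (γ ω α T : ℝ) (φ : ℝ → ℝ)
    (hγ : -1 < γ) (hγ' : γ < 0)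
    (hω : 0 < ω) (hω' : ω < Real.pi / 2)
    (hA : AlmostSectorial.IsAlmostSectorial A ω γ)
    (hα : 0 < α) (hα' : α < Real.pi / (2 * ω))
    (hT : 0 < T)
    (hφ : ContinuousOn φ (Ici 0)) (hφ_nonneg : ∀ t, 0 ≤ t → 0 ≤ φ t)
    (hφ_pos : ∀ t, 0 < t → 0 < φ t) :
    -- `𝒯_α(t)` is given by an absolutely convergent integral over any admissible path
    (∀ t ∈ AlmostSectorial.openSector (Real.pi / 2 - α * ω),
      ∀ θ : ℝ, ω < θ → θ < AlmostSectorial.angleBound α t →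
        AlmostSectorial.ContourIntegrable A (AlmostSectorial.expFun α t) θ ∧
        AlmostSectorial.fracSemigroup A ω α t =
          AlmostSectorial.contourOp A (AlmostSectorial.expFun α t) θ) ∧
    -- `𝒯_α` is an analytic semigroup of growth order `(1 + γ) / α`
    AlmostSectorial.IsAnalyticSemigroupOfGrowthOrder (AlmostSectorial.fracSemigroup A ω α)
      (Real.pi / 2 - α * ω) ((1 + γ) / α) ∧
    -- the solution operator is `𝒯_α(∫₀ᵗ φ(s) ds)`
    AlmostSectorial.IsSolutionOperator A ω α φ T
      (fun t => AlmostSectorial.fracSemigroup A ω α ((∫ s in (0 : ℝ)..t, φ s : ℝ) : ℂ)) ∧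
    -- solutions with values continuous at `0` in the norm of `X`
    (∀ (u₀ : X) (u : ℝ → X),
      (AlmostSectorial.IsClassicalSolution (AlmostSectorial.fracPower A ω α) φ T u ∧
          AlmostSectorial.HasStrongInitialValue u u₀) ↔
        u₀ ∈ AlmostSectorial.continuitySet (AlmostSectorial.fracSemigroup A ω α) ∧
          ∀ t ∈ Ioo 0 T, u t =
            AlmostSectorial.fracSemigroup A ω α ((∫ s in (0 : ℝ)..t, φ s : ℝ) : ℂ) u₀) := by
  have hαω : α * ω < Real.pi / 2 := by
    rw [lt_div_iff₀ (by positivity)] at hα'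
    linarith
  have hadm : ∀ x < Real.pi / 2 - α * ω, ∃ θ, Admissible A ω γ α θ ∧ x < Real.pi / 2 - α * θ :=
    fun x hx => exists_admissible hA hω.le hω' hγ hγ' hα hx
  -- A single path serves all real t > 0, hence the growth bound and the Cauchy problem. For complex
  -- t the angle must shrink towards ω as |arg t| approaches π/2 - αω.
  obtain ⟨θ₀, h₀, hθ₀⟩ := hadm 0 (by linarith)
  have hδ : α * θ₀ < Real.pi / 2 := by linarith
  refine ⟨fun t ht θ hωθ hθ => ?_, ⟨by linarith, ?_, ?_, ?_, ?_, ?_, ?_⟩, ?_, fun u₀ u => ?_⟩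
  · obtain ⟨h1, h2⟩ := (lt_angleBound_iff hα ht.1).1 hθ
    exact ⟨(sectorDecay_expFun hα h1 h2).contourIntegrable hA hω.le hγ hγ' h1.le hωθ,
      fracSemigroup_eq hA hω.le hγ hγ' hα ht.1 hωθ hθ⟩
  · linarith [mul_pos hα hω]
  · exact div_pos (by linarith) hα
  · intro t ht s hs
    -- The path has to be admissible for t and s at once; it is then admissible for t + s as well.
    obtain ⟨θ, h, hx⟩ := hadm (max |t.arg| |s.arg|) (max_lt ht.2 hs.2)
    exact h.fracSemigroup_add ⟨ht.1, (le_max_left _ _).trans_lt hx⟩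
      ⟨hs.1, (le_max_right _ _).trans_lt hx⟩
  · intro t ht
    obtain ⟨θ, h, hx⟩ := hadm _ ht.2
    exact h.analyticOnNhd t ⟨ht.1, hx⟩
  · exact h₀.exists_growth_bound hδ
  · intro t ht x hx
    obtain ⟨θ, h, hx'⟩ := hadm _ ht.2
    exact h.eq_zero_of_fracSemigroup_eq_zero ⟨ht.1, hx'⟩ hx
  · exact h₀.isSolutionOperator hδ hT hφ hφ_pos
  · constructor
    · rintro ⟨hu, hu₀⟩
      have heq := fun t ht => h₀.eq_of_isClassicalSolution hδ hφ hφ_pos hu hu₀.hasInitialValue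
        (t := t) ht
      exact ⟨(Admissible.hasStrongInitialValue_iff hT hφ hφ_pos heq).1 hu₀, heq⟩
    · rintro ⟨hu₀, heq⟩
      exact ⟨h₀.isClassicalSolution hδ hφ hφ_pos heq,
        (Admissible.hasStrongInitialValue_iff hT hφ hφ_pos heq).2 hu₀⟩
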